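/- Let $\operatorname{Li}_2$ denote the principal branch of the dilogarithm, $\operatorname{Li}_2(z)=-\int_0^1 \frac{\ln(1-tz)}{t}\,dt$ (so $\operatorname{Li}_2(z)=\sum_{n\ge 1} z^n/n^2$ for $|z|\le 1$), let $\ln$ be the principal logarithm, let $\sqrt{4-3u^2}$ be the principal square root, and let $\sqrt{3u^2-4}:=i\sqrt{4-3u^2}$, i.e. the branch with $-i\sqrt{3u^2-4}=\sqrt{4-3u^2}$ (for $\Re u\ge 0$, $\Im u>0$ it is the principal one). Put \begin{align*} A & := \operatorname{Li}_2\left(\tfrac{\sqrt{4 - 3u^2} + u^2 - 2}{u (u + 1)}\right) - \operatorname{Li}_2\left(\tfrac{\sqrt{4 - 3u^2} + u^2 - 2}{(u - 1) u}\right), \\ B & := \tfrac{1}{2} \ln^2\left(\tfrac{-i \sqrt{3 u^2-4}+u+2}{4} \right) - \tfrac{1}{2} \ln ^2\left(\tfrac{- i \sqrt{3 u^2 - 4} - u^2 +2}{u (u+1)}\right) + \tfrac{1}{2} \ln ^2\left(\tfrac{i \sqrt{3 u^2 - 4} + u + 2}{4} \right)-\tfrac{\pi ^2}{6}, \\ J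 & := \tfrac{1}{4} \ln^2 \left( \tfrac{-4}{-i \sqrt{3 u^2 - 4} + u + 2} \right) + \tfrac{1}{4} \ln^2 \left( \tfrac{-4}{i \sqrt{3 u^2 - 4} + u + 2} \right) - \tfrac{1}{4} \ln^2 \left( \tfrac{-4}{-i \sqrt{3 u^2 - 4} - u + 2} \right) - \tfrac{1}{4} \ln^2 \left( \tfrac{-4}{i \sqrt{3 u^2 - 4} - u + 2} \right), \\ C & := - \tfrac{1}{2} \ln \left( \tfrac{ - i \sqrt{3 u^2 - 4} + u + 2}{4} \right) \ln \left( \tfrac{ i \sqrt{3 u^2 - 4} - u + 2}{4} \right) - \tfrac{1}{2} \ln \left( \tfrac{i \sqrt{3 u^2 - 4} + u + 2}{4} \right) \ln \left( \tfrac{- i \sqrt{3 u^2 - 4} - u + 2}{4} \right) + \tfrac{\pi^2}{6}, \\ H & := \tfrac{1}{4} \ln^2\left(\tfrac{2}{u-1}\right)-\tfrac{1}{4} \ln ^2\left(-\tfrac{2}{u+1}\right)+\tfrac{1}{2} \ln \left(\tfrac{-u + 1}{2} \right) \ln \left(\tfrac{u+1}{2}\right) - \tfrac{\pi i}{2} \ln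 \left(\tfrac{u + 1}{u-1}\right)-\ln (2) \ln \left(\tfrac{u+1}{u-1}\right)-\tfrac{\pi^2}{12}, \\ D & := \operatorname{Li}_2 \left( \tfrac{1 - u}{2} \right) + \ln(2) \ln \left( \tfrac{u - 1}{u + 1} \right) + \left( 2 \ln(2) + \tfrac{\pi i}{2} \right) \ln \left( \tfrac{u + 1}{u - 1} \right), \\ K & := \tfrac{1}{2} \operatorname{Li}_2 \left( \tfrac{2}{- \sqrt{4 - 3 u^2} + u} \right) - \tfrac{1}{2} \operatorname{Li}_2 \left( \tfrac{2}{\sqrt{4 - 3 u^2} - u} \right) - \tfrac{1}{2} \operatorname{Li}_2 \left( \tfrac{-2}{\sqrt{4 - 3 u^2} + u} \right) + \tfrac{1}{2} \operatorname{Li}_2 \left( \tfrac{2}{\sqrt{4 - 3 u^2} + u} \right) + \tfrac{1}{2} \operatorname{Li}_2 \left( \tfrac{-1}{u} \right) - \tfrac{1}{2} \operatorname{Li}_2 \left( \tfrac{1}{u} \right), \\ M & := - \operatorname{Li}_{2}\left( \tfrac{\sqrt{4 - 3 u^2} - u + 2}{4} \right) - \operatorname{Li}_{2}\left( \tfrac{-\sqrt{4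 - 3 u^2} - u + 2}{4} \right), \end{align*} and, with $(a)_n=a(a+1)\cdots(a+n-1)$ and for $u(u^2-1)\neq 0$, \[ s_3 := \frac{2}{3u(u^2-1)} \sum_{n=0}^{\infty} \left( \frac{1}{u(u^2-1)} \right)^{2n} \left( \frac{4}{27} \right)^{n} \frac{(1/2)_n\,(1/2)_n\,(1)_n}{(5/6)_n\,(7/6)_n\,(3/2)_n}. \] (1) Let $u\in\mathbb{C}\setminus\mathbb{R}$ with $\Re u\ge 0$ be such that the series converges. Then $s_3=K$ and $A+B=M$. If moreover $u(u^2-1)\notin\mathbb{R}$, then $A+B+J+C+H+D=s_3$. In every case $A+B+J+C+H+D$, evaluated at non-real $v$ with $v(v^2-1)\notin\mathbb{R}$, tends to $s_3(u)$ as $v\to u$. (2) Let $u\ge 0$ be real with $u(u^2-1)\ne 0$ and such that the series converges. As $v\in\mathbb{C}\setminus\mathbb{R}$ tends to $u$, the quantities $A+B+J+C+H+D$ (over $v$ with $v(v^2-1)\notin\mathbb{R}$), $s_3$ (over $v$ at which the series converges) and $K$, evaluated at $v$, have one and the same limit, namely $s_3(u)$; and the quantities $A+B$ and $M$, evaluated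 at $v$, have one and the same limit, namely $M(u)$. -/

import Mathlib

open Filter Topology

/-- The principal branch of the dilogarithm, `Li₂(z) = -∫₀¹ log (1 - t z) / t dt`: it is
analytic on `ℂ \ [1, ∞)`, and it equals `∑_{n ≥ 1} zⁿ / n²` for `‖z‖ ≤ 1`. -/
noncomputable def Li2 (z : ℂ) : ℂ :=
  -∫ t in (0 : ℝ)..1, Complex.log (1 - (t : ℂ) * z) / (t : ℂ)

/-- The square root `√(4 - 3u²)` (principal branch). -/
noncomputable def sqrtS (u : ℂ) : ℂ := Complex.sqrt (4 - 3 * u ^ 2)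

/-- The square root `√(3u² - 4)`, on the branch tied to the principal `√(4 - 3u²)` by
`-i √(3u² - 4) = √(4 - 3u²)`. -/
noncomputable def sqrtR (u : ℂ) : ℂ := Complex.I * sqrtS u

theorem neg_I_mul_sqrtR (u : ℂ) : -Complex.I * sqrtR u = sqrtS u := by
  rw [sqrtR, ← mul_assoc, neg_mul, Complex.I_mul_I, neg_neg, one_mul]

theorem sqrtR_sq (u : ℂ) : sqrtR u ^ 2 = 3 * u ^ 2 - 4 := by
  have h : sqrtS u ^ 2 = 4 - 3 * u ^ 2 := by
    have := Complex.cpow_nat_inv_pow (4 - 3 * u ^ 2) (n := 2) two_ne_zero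
    exact this
  rw [sqrtR, mul_pow, h, Complex.I_sq]
  ring

/-- In the open upper half of the half-plane `Re u ≥ 0`, `sqrtR` is the principal square root. -/
theorem sqrtR_eq_principal (u : ℂ) (hre : 0 ≤ u.re) (him : 0 < u.im) :
    sqrtR u = Complex.sqrt (3 * u ^ 2 - 4) := by
  have e : (3 * u ^ 2 - 4 : ℂ) = -(4 - 3 * u ^ 2) := by ring
  have him' : (4 - 3 * u ^ 2 : ℂ).im = -(6 * (u.re * u.im)) := by
    simp [pow_two]; ring
  have hre' : (4 - 3 * u ^ 2 : ℂ).re = 4 - 3 * (u.re ^ 2 - u.im ^ 2) := by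
    simp [pow_two]
  have harg : (4 - 3 * u ^ 2 : ℂ).im < 0 ∨
      (4 - 3 * u ^ 2 : ℂ).im = 0 ∧ 0 < (4 - 3 * u ^ 2 : ℂ).re := by
    rcases hre.lt_or_eq with h | h
    · left; rw [him']; have := mul_pos h him; linarith
    · right; rw [him', hre', ← h]; constructor
      · simp
      · nlinarith [sq_nonneg u.im]
  have hz : (4 - 3 * u ^ 2 : ℂ) ≠ 0 := by
    intro h0; rw [h0] at harg; simp at harg
  have ha : Complex.arg (-(4 - 3 * u ^ 2)) = Complex.arg (4 - 3 * u ^ 2) + Real.pi := by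
    exact Complex.arg_neg_eq_arg_add_pi_iff.mpr harg
  have hl : Complex.log (-(4 - 3 * u ^ 2))
      = Complex.log (4 - 3 * u ^ 2) + Real.pi * Complex.I := by
    rw [Complex.log, Complex.log, ha, norm_neg]; push_cast; ring
  rw [e, sqrtR, sqrtS, Complex.sqrt, Complex.sqrt, Complex.cpow_def_of_ne_zero hz,
    Complex.cpow_def_of_ne_zero (neg_ne_zero.mpr hz), hl, add_mul, Complex.exp_add]
  have : Complex.exp (Real.pi * Complex.I * 2⁻¹) = Complex.I := by
    rw [show (Real.pi * Complex.I * 2⁻¹ : ℂ) = Real.pi / 2 * Complex.I by ring]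
    exact Complex.exp_pi_div_two_mul_I
  rw [this, mul_comm]

open Complex in
noncomputable def termA (u : ℂ) : ℂ :=
  Li2 ((sqrtS u + u ^ 2 - 2) / (u * (u + 1))) - Li2 ((sqrtS u + u ^ 2 - 2) / ((u - 1) * u))

open Complex in
noncomputable def termB (u : ℂ) : ℂ :=
  1 / 2 * log ((-I * sqrtR u + u + 2) / 4) ^ 2
    - 1 / 2 * log ((-I * sqrtR u - u ^ 2 + 2) / (u * (u + 1))) ^ 2
    + 1 / 2 * log ((I * sqrtR u + u + 2) / 4) ^ 2 - (Real.pi : ℂ) ^ 2 / 6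

open Complex in
noncomputable def termJ (u : ℂ) : ℂ :=
  1 / 4 * log (-4 / (-I * sqrtR u + u + 2)) ^ 2
    + 1 / 4 * log (-4 / (I * sqrtR u + u + 2)) ^ 2
    - 1 / 4 * log (-4 / (-I * sqrtR u - u + 2)) ^ 2
    - 1 / 4 * log (-4 / (I * sqrtR u - u + 2)) ^ 2

open Complex in
noncomputable def termC (u : ℂ) : ℂ :=
  -(1 / 2) * log ((-I * sqrtR u + u + 2) / 4) * log ((I * sqrtR u - u + 2) / 4)
    - 1 / 2 * log ((I * sqrtR u + u + 2) / 4) * log ((-I * sqrtR u - u + 2) / 4)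
    + (Real.pi : ℂ) ^ 2 / 6

open Complex in
noncomputable def termH (u : ℂ) : ℂ :=
  1 / 4 * log (2 / (u - 1)) ^ 2 - 1 / 4 * log (-(2 / (u + 1))) ^ 2
    + 1 / 2 * log ((-u + 1) / 2) * log ((u + 1) / 2)
    - Real.pi * I / 2 * log ((u + 1) / (u - 1))
    - log 2 * log ((u + 1) / (u - 1)) - (Real.pi : ℂ) ^ 2 / 12

open Complex in
noncomputable def termD (u : ℂ) : ℂ :=
  Li2 ((1 - u) / 2) + log 2 * log ((u - 1) / (u + 1))
    + (2 * log 2 + Real.pi * I / 2) * log ((u + 1) / (u - 1))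

noncomputable def termK (u : ℂ) : ℂ :=
  1 / 2 * Li2 (2 / (-sqrtS u + u)) - 1 / 2 * Li2 (2 / (sqrtS u - u))
    - 1 / 2 * Li2 (-2 / (sqrtS u + u)) + 1 / 2 * Li2 (2 / (sqrtS u + u))
    + 1 / 2 * Li2 (-1 / u) - 1 / 2 * Li2 (1 / u)

/-- `-Li₂((√(4 - 3u²) - u + 2)/4) - Li₂((-√(4 - 3u²) - u + 2)/4)`. -/
noncomputable def termM (u : ℂ) : ℂ :=
  -Li2 ((sqrtS u - u + 2) / 4) - Li2 ((-sqrtS u - u + 2) / 4)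

/-- The rising factorial `(a)_n = a (a + 1) ⋯ (a + n - 1)`. -/
noncomputable def poch (a : ℂ) (n : ℕ) : ℂ := (ascPochhammer ℂ n).eval a

/-- The `n`-th term of the power series. -/
noncomputable def s3Term (u : ℂ) (n : ℕ) : ℂ :=
  (1 / (u * (u ^ 2 - 1))) ^ (2 * n) * (4 / 27) ^ n *
    ((poch (1 / 2) n * poch (1 / 2) n * poch 1 n) /
      (poch (5 / 6) n * poch (7 / 6) n * poch (3 / 2) n))

/-- The power series is defined and converges at `u`. -/
def S3Converges (u : ℂ) : Prop := u * (u ^ 2 - 1) ≠ 0 ∧ Summable (s3Term u)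

/-- The value `s₃`. -/
noncomputable def s3 (u : ℂ) : ℂ := 2 / (3 * u * (u ^ 2 - 1)) * ∑' n, s3Term u n

/-- The left-hand side `A + B + J + C + H + D`. -/
noncomputable def sumABJCHD (u : ℂ) : ℂ :=
  termA u + termB u + termJ u + termC u + termH u + termD u

/-! Put x = 1/(u(u² - 1)). Every quantity is compared with one integral, `humpIntegral x` = ∫₀¹
artanh(x(t - t³))/t dt.

Expanding artanh and integrating termwise produces the moments ∫₀¹ t²ⁿ(1 - t²)²ⁿ⁺¹ dt, whose
successive ratios are the hypergeometric ones. Hence s₃ is this integral (`s3_eq_humpIntegral`). The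
series converges exactly for |x|² ≤ 27/4, and 4/27 is the maximum of (t - t³)² on [0, 1].

The integral is a sum of dilogarithms in two ways. Let w run over the roots of w³ - w = u³ - u,
namely u and (-u ± √(4 - 3u²))/2. Since 1 + x(t - t³) = ∏(1 - t/w), it is half the sum of Li₂(-1/w)
- Li₂(1/w), which is K (`sum_Li2_inv_roots`). Putting 1 - 2t for t inside the cubic alone does not
change its value (`integral_hump_one_sub_two_mul`), but the zeros in t become (1 ± w)/2, so it is
also half the sum of Li₂(2/(1 + w)) - Li₂(2/(1 - w)) (`sum_Li2_two_div_roots`). Inversion and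
reflection turn the latter into M + J + C + H + D, and A + B = M by Landen and reflection.

For non-real x all roots are non-real and no branch cut is met. If u is non-real but x is real, then
x² < 27/4, so the integral is still continuous there and the long sum has the right limit. For real
u with u² > 4/3 the same continuity applies. The remaining real points, u² = 1/3 and u² = 4/3, are
double roots of the cubic: there the two colliding roots lie in opposite half-planes, their
logarithmic jumps cancel in the limit (`exists_tendsto_rootTerm_sum`), and the limit is identified
along points where the series converges, s₃ being continuous up to the boundary. -/

/-! ### Logarithms and the plane cut along `[1, ∞)` -/

/-- The plane cut along `[1, ∞)`. -/
def cutPlane : Set ℂ := {z | 1 - z ∈ Complex.slitPlane}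

theorem isOpen_cutPlane : IsOpen cutPlane :=
  Complex.isOpen_slitPlane.preimage (by fun_prop : Continuous fun z : ℂ => 1 - z)

theorem zero_mem_cutPlane : (0 : ℂ) ∈ cutPlane := by simp [cutPlane]

theorem mem_cutPlane_of_im_ne_zero {z : ℂ} (h : z.im ≠ 0) : z ∈ cutPlane :=
  Or.inr (by simpa using h)

theorem mem_cutPlane_of_re_lt_one {z : ℂ} (h : z.re < 1) : z ∈ cutPlane :=
  Or.inl (by simpa using h)

theorem one_sub_ne_zero_of_mem_cutPlane {z : ℂ} (h : z ∈ cutPlane) : 1 - z ≠ 0 :=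
  Complex.slitPlane_ne_zero h

theorem mul_mem_cutPlane {z : ℂ} (hz : z ∈ cutPlane) {t : ℝ} (ht : t ∈ Set.Icc (0 : ℝ) 1) :
    z * t ∈ cutPlane := by
  have h := Complex.starConvex_one_slitPlane hz (a := 1 - t) (b := t)
    (by linarith [ht.2]) ht.1 (by ring)
  have e : (1 - t : ℝ) • (1 : ℂ) + t • (1 - z) = 1 - z * t := by
    simp only [Complex.real_smul]; push_cast; ring
  rwa [e] at h

theorem starConvex_cutPlane : StarConvex ℝ 0 cutPlane := by
  intro z hz a b ha hb hab
  have := mul_mem_cutPlane hz (t := b) ⟨hb, by linarith⟩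
  simpa [mul_comm] using this

/-- A continuous function on a preconnected set whose exponential is `1` vanishes if it
vanishes somewhere. -/
theorem eq_zero_of_exp_eq_one {α : Type*} [TopologicalSpace α] {s : Set α} {f : α → ℂ}
    (hs : IsPreconnected s) (hf : ContinuousOn f s) (he : ∀ x ∈ s, Complex.exp (f x) = 1)
    {a : α} (ha : a ∈ s) (h0 : f a = 0) {x : α} (hx : x ∈ s) : f x = 0 := by
  have hpi := Real.pi_pos
  have key : ∀ y ∈ s, ∃ n : ℤ, f y = n * (2 * Real.pi * Complex.I) := fun y hy =>
    Complex.exp_eq_one_iff.1 (he y hy)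
  -- The values of `f` lie in 2πiℤ, so `g` is continuous and integer-valued, hence constant.
  let g : α → ℝ := fun y => (f y).im / (2 * Real.pi)
  have hg : ContinuousOn g s := (Complex.continuous_im.comp_continuousOn hf).div_const _
  have hgn : ∀ y ∈ s, ∀ n : ℤ, f y = n * (2 * Real.pi * Complex.I) → g y = n := by
    intro y hy n hn
    simp only [g, hn]
    simp
  have hd : IsDiscrete (Set.range ((↑) : ℤ → ℝ)) := by
    refine ⟨?_⟩
    exact (Int.isClosedEmbedding_coe_real.isEmbedding.toHomeomorph).symm.isEmbedding.discreteTopology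
  obtain ⟨c, hc⟩ := hs.eqOn_const_of_mapsTo hd hg (by
    intro y hy
    obtain ⟨n, hn⟩ := key y hy
    exact ⟨n, (hgn y hy n hn).symm⟩) ⟨0, 0, by simp⟩
  have hc' : ∀ y ∈ s, g y = c := fun y hy => hc.2 hy
  obtain ⟨n, hn⟩ := key x hx
  have h1 : g a = 0 := by simp [g, h0]
  have h2 : (n : ℝ) = 0 := by rw [← hgn x hx n hn, hc' x hx, ← hc' a ha, h1]
  have h3 : n = 0 := by exact_mod_cast h2
  simp [hn, h3]

/-- Both sides have the same exponential and agree at 1/2; the doubly slit plane is star-shaped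
about 1/2, so they agree along the segment to `z`. -/
theorem log_div_one_sub {z : ℂ} (hz : z ∈ Complex.slitPlane) (hz' : 1 - z ∈ Complex.slitPlane) :
    Complex.log (z / (1 - z)) = Complex.log z - Complex.log (1 - z) := by
  have hmem : ∀ t ∈ Set.Icc (0 : ℝ) 1, (1 / 2 + t * (z - 1 / 2) : ℂ) ∈ Complex.slitPlane := by
    intro t ht
    have h := Complex.starConvex_ofReal_slitPlane (x := 1 / 2) (by norm_num) hz
      (a := 1 - t) (b := t) (by linarith [ht.2]) ht.1 (by ring)
    convert h using 1
    simp only [Complex.real_smul]; push_cast; ring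
  have hmem' : ∀ t ∈ Set.Icc (0 : ℝ) 1,
      1 - (1 / 2 + t * (z - 1 / 2) : ℂ) ∈ Complex.slitPlane := by
    intro t ht
    have h := Complex.starConvex_ofReal_slitPlane (x := 1 / 2) (by norm_num) hz'
      (a := 1 - t) (b := t) (by linarith [ht.2]) ht.1 (by ring)
    convert h using 1
    simp only [Complex.real_smul]; push_cast; ring
  -- If w/(1 - w) = r ≤ 0, then w = r/(1 + r) and 1 - w = 1/(1 + r) are real; both being positive
  -- would force r > 0.
  have hquot : ∀ w : ℂ, w ∈ Complex.slitPlane → 1 - w ∈ Complex.slitPlane →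
      w / (1 - w) ∈ Complex.slitPlane := by
    intro w hw hw'
    have h1 := Complex.slitPlane_ne_zero hw'
    rw [Complex.mem_slitPlane_iff_not_le_zero] at hw hw' ⊢
    intro hle
    obtain ⟨hre, him⟩ := Complex.le_def.1 hle
    simp only [Complex.zero_re, Complex.zero_im] at hre him
    obtain ⟨r, hr⟩ : ∃ r : ℝ, w / (1 - w) = r := ⟨(w / (1 - w)).re, by
      apply Complex.ext <;> simp [him]⟩
    have hr0 : r ≤ 0 := by rw [hr] at hre; simpa using hre
    rw [div_eq_iff h1] at hr
    have h2 : w * (1 + r) = r := by linear_combination hr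
    have h3 : (1 + r : ℂ) ≠ 0 := by
      intro h; rw [h, mul_zero] at h2; rw [← h2] at h; simp at h
    have h4 : w = ((r / (1 + r) : ℝ) : ℂ) := by
      push_cast; rw [eq_div_iff h3, h2]
    rw [h4] at hw hw'
    have h3' : 1 + r ≠ 0 := by intro h; apply h3; exact_mod_cast h
    have h5 : (1 - ((r / (1 + r) : ℝ) : ℂ)) = ((1 / (1 + r) : ℝ) : ℂ) := by
      push_cast; field_simp; ring
    rw [h5] at hw'
    have hw2 : 0 < r / (1 + r) := not_le.1 fun h => hw (by exact_mod_cast h)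
    have hw3 : 0 < 1 / (1 + r) := not_le.1 fun h => hw' (by exact_mod_cast h)
    have : 0 < 1 + r := by simpa using hw3
    have := (div_pos_iff_of_pos_right this).1 hw2
    linarith
  have hc : Continuous fun t : ℝ => (1 / 2 + t * (z - 1 / 2) : ℂ) := by fun_prop
  have h := eq_zero_of_exp_eq_one (s := Set.Icc (0 : ℝ) 1) (a := 0) (x := 1)
    (f := fun t => Complex.log ((1 / 2 + t * (z - 1 / 2)) / (1 - (1 / 2 + t * (z - 1 / 2))))
      - (Complex.log (1 / 2 + t * (z - 1 / 2)) - Complex.log (1 - (1 / 2 + t * (z - 1 / 2)))))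
    isPreconnected_Icc ?_ ?_ (by simp) ?_ (by simp)
  · have e : (1 / 2 + ((1 : ℝ) : ℂ) * (z - 1 / 2)) = z := by push_cast; ring
    simp only [e] at h
    exact sub_eq_zero.1 h
  · refine ContinuousOn.sub (ContinuousOn.clog ?_ ?_) (ContinuousOn.sub (ContinuousOn.clog ?_ ?_)
      (ContinuousOn.clog ?_ ?_))
    · exact ContinuousOn.div hc.continuousOn (by fun_prop)
        fun t ht => Complex.slitPlane_ne_zero (hmem' t ht)
    · exact fun t ht => hquot _ (hmem t ht) (hmem' t ht)
    · exact hc.continuousOn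
    · exact hmem
    · fun_prop
    · exact hmem'
  · intro t ht
    have h1 := Complex.slitPlane_ne_zero (hmem t ht)
    have h2 := Complex.slitPlane_ne_zero (hmem' t ht)
    rw [Complex.exp_sub, Complex.exp_sub, Complex.exp_log h1, Complex.exp_log h2,
      Complex.exp_log (div_ne_zero h1 h2), div_self (div_ne_zero h1 h2)]
  · have : (1 / 2 + ((0 : ℝ) : ℂ) * (z - 1 / 2)) = 1 / 2 := by simp
    simp only [this]
    norm_num

/-- The numbers -z and 1 - z have the same non-zero imaginary part, so their arguments lie both in
[0, π) or both in (-π, 0) and differ by less than π. -/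
theorem log_neg_div_one_sub {z : ℂ} (hz : z.im ≠ 0) :
    Complex.log (-z / (1 - z)) = Complex.log (-z) - Complex.log (1 - z) := by
  have h0 : -z ≠ 0 := by rintro h; apply hz; rw [neg_eq_zero.1 h]; simp
  have h1 : 1 - z ≠ 0 := by
    intro h; apply hz; rw [← sub_eq_zero.1 h]; simp
  have e : Complex.exp (Complex.log (-z) - Complex.log (1 - z)) = -z / (1 - z) := by
    rw [Complex.exp_sub, Complex.exp_log h0, Complex.exp_log h1]
  have hi1 : (-z).im = -z.im := by simp
  have hi2 : (1 - z).im = -z.im := by simp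
  have b : -Real.pi < (-z).arg - (1 - z).arg ∧ (-z).arg - (1 - z).arg < Real.pi := by
    rcases lt_or_gt_of_ne hz with h | h
    · have a1 := Complex.arg_nonneg_iff.2 (by rw [hi1]; linarith : 0 ≤ (-z).im)
      have a2 := Complex.arg_nonneg_iff.2 (by rw [hi2]; linarith : 0 ≤ (1 - z).im)
      have a3 := Complex.arg_lt_pi_iff.2 (Or.inr (by rw [hi1]; linarith : (-z).im ≠ 0))
      have a4 := Complex.arg_lt_pi_iff.2 (Or.inr (by rw [hi2]; linarith : (1 - z).im ≠ 0))
      constructor <;> linarith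
    · have a1 := Complex.arg_neg_iff.2 (by rw [hi1]; linarith : (-z).im < 0)
      have a2 := Complex.arg_neg_iff.2 (by rw [hi2]; linarith : (1 - z).im < 0)
      have a3 := Complex.neg_pi_lt_arg (-z)
      have a4 := Complex.neg_pi_lt_arg (1 - z)
      constructor <;> linarith
  rw [← e, Complex.log_exp]
  · simp only [Complex.sub_im, Complex.log_im]; exact b.1
  · simp only [Complex.sub_im, Complex.log_im]; exact b.2.le

/-! ### The quotient `log (1 - z) / z` -/

/-- The function `log (1 - z) / z`, with its removable singularity at `0` filled in. -/
noncomputable def logQuot (z : ℂ) : ℂ := dslope (fun w => Complex.log (1 - w)) 0 z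

theorem mul_logQuot (z : ℂ) : z * logQuot z = Complex.log (1 - z) := by
  simpa [logQuot] using sub_smul_dslope (fun w => Complex.log (1 - w)) 0 z

theorem hasDerivAt_log_one_sub {z : ℂ} (hz : z ∈ cutPlane) :
    HasDerivAt (fun w => Complex.log (1 - w)) (-1 / (1 - z)) z := by
  exact ((hasDerivAt_id z).const_sub 1).clog hz

theorem logQuot_zero : logQuot 0 = -1 := by
  rw [logQuot, dslope_same, (hasDerivAt_log_one_sub zero_mem_cutPlane).deriv]
  simp

theorem logQuot_of_ne {z : ℂ} (hz : z ≠ 0) : logQuot z = Complex.log (1 - z) / z := by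
  rw [← mul_logQuot, mul_div_cancel_left₀ _ hz]

theorem continuousOn_logQuot : ContinuousOn logQuot cutPlane := by
  refine (continuousOn_dslope (isOpen_cutPlane.mem_nhds zero_mem_cutPlane)).2 ⟨?_, ?_⟩
  · exact fun z hz => (hasDerivAt_log_one_sub hz).continuousAt.continuousWithinAt
  · exact (hasDerivAt_log_one_sub zero_mem_cutPlane).differentiableAt

/-- Differentiation of `∫₀¹ log (1 - z φ(t)) / t dt` under the integral sign, where
`φ(t) = t k(t)`. -/
theorem hasDerivAt_integral_logQuot {φ k : ℝ → ℝ} (hφ : Continuous φ) (hk : Continuous k)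
    (hφk : ∀ t, φ t = t * k t) {U : Set ℂ} (hU : IsOpen U)
    (hmem : ∀ z ∈ U, ∀ t ∈ Set.Icc (0 : ℝ) 1, z * φ t ∈ cutPlane) {z : ℂ} (hz : z ∈ U) :
    HasDerivAt (fun w : ℂ => ∫ t in (0 : ℝ)..1, w * k t * logQuot (w * φ t))
      (∫ t in (0 : ℝ)..1, -(k t : ℂ) / (1 - z * φ t)) z := by
  have hI : Set.uIoc (0 : ℝ) 1 ⊆ Set.Icc 0 1 := by
    rw [Set.uIoc_of_le zero_le_one]; exact Set.Ioc_subset_Icc_self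
  have hcont : ∀ w ∈ U, ContinuousOn (fun t : ℝ => w * k t * logQuot (w * φ t))
      (Set.Icc 0 1) := fun w hw =>
    ContinuousOn.mul (by fun_prop)
      (continuousOn_logQuot.comp (by fun_prop) fun t ht => hmem w hw t ht)
  have hcont2 : ContinuousOn (fun p : ℂ × ℝ => -(k p.2 : ℂ) / (1 - p.1 * φ p.2))
      (U ×ˢ Set.Icc 0 1) :=
    ContinuousOn.div (by fun_prop) (by fun_prop)
      fun p hp => one_sub_ne_zero_of_mem_cutPlane (hmem p.1 hp.1 p.2 hp.2)
  -- Compactness of a small closed ball times [0, 1] turns joint continuity of the derivative into a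
  -- constant dominating bound.
  obtain ⟨r, hr, hrU⟩ := Metric.nhds_basis_closedBall.mem_iff.1 (hU.mem_nhds hz)
  obtain ⟨C, hC⟩ := ((isCompact_closedBall z r).prod (isCompact_Icc (a := (0 : ℝ)) (b := 1))
    ).exists_bound_of_continuousOn (hcont2.mono (Set.prod_mono_left hrU))
  refine (intervalIntegral.hasDerivAt_integral_of_dominated_loc_of_deriv_le
    (F' := fun w t => -(k t : ℂ) / (1 - w * φ t)) (bound := fun _ => C)
    (Metric.closedBall_mem_nhds z hr) ?_ ?_ ?_ ?_ ?_ ?_).2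
  · filter_upwards [hU.mem_nhds hz] with w hw
    exact ((hcont w hw).mono hI).aestronglyMeasurable measurableSet_uIoc
  · exact ContinuousOn.intervalIntegrable (by rw [Set.uIcc_of_le zero_le_one]; exact hcont z hz)
  · refine ContinuousOn.aestronglyMeasurable (fun t ht => ?_) measurableSet_uIoc
    have := hcont2.comp (f := fun t : ℝ => (z, t)) (s := Set.Icc 0 1) (by fun_prop)
      fun t ht => ⟨hz, ht⟩
    exact this.mono hI t ht
  · exact Eventually.of_forall fun t ht w hw => hC (w, t) ⟨hw, hI ht⟩
  · simp
  · refine Eventually.of_forall fun t ht w hw => ?_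
    have hd := hmem w (hrU hw) t (hI ht)
    rcases eq_or_ne t 0 with h0 | h0
    · have hφ0 : φ t = 0 := by rw [hφk, h0, zero_mul]
      simp only [hφ0]
      simpa [logQuot_zero] using (hasDerivAt_id w).mul_const (-(k t : ℂ))
    · have ht0 : (t : ℂ) ≠ 0 := by exact_mod_cast h0
      have hφ' : (φ t : ℂ) = t * k t := by rw [hφk]; push_cast; ring
      have e : (fun w : ℂ => w * k t * logQuot (w * φ t))
          = fun w => Complex.log (1 - w * φ t) / t := by
        funext w
        rw [← mul_logQuot, hφ']; field_simp
      rw [e]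
      have h1 : HasDerivAt (fun w : ℂ => 1 - w * φ t) (-(φ t : ℂ)) w := by
        simpa using ((hasDerivAt_id w).mul_const (φ t : ℂ)).const_sub 1
      have h2 := (h1.clog hd).div_const (t : ℂ)
      refine h2.congr_deriv ?_
      have := one_sub_ne_zero_of_mem_cutPlane hd
      rw [hφ'] at this ⊢
      field_simp

/-- This form has an integrand continuous up to t = 0, so integrability and differentiation in `z`
follow from compactness. -/
theorem Li2_eq_integral_logQuot (z : ℂ) :
    Li2 z = -∫ t in (0 : ℝ)..1, z * logQuot (z * t) := by
  rw [Li2, neg_inj]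
  refine intervalIntegral.integral_congr_ae (Eventually.of_forall fun t ht => ?_)
  rw [Set.uIoc_of_le zero_le_one] at ht
  have ht0 : (t : ℂ) ≠ 0 := by exact_mod_cast ht.1.ne'
  rw [mul_comm (t : ℂ) z, ← mul_logQuot]
  field_simp

theorem Li2_zero : Li2 0 = 0 := by simp [Li2_eq_integral_logQuot]

theorem hasDerivAt_Li2 {z : ℂ} (hz : z ∈ cutPlane) : HasDerivAt Li2 (-logQuot z) z := by
  have h := hasDerivAt_integral_logQuot (φ := fun t => t) (k := fun _ => 1) continuous_id
    continuous_const (by simp) isOpen_cutPlane (fun z hz t ht => mul_mem_cutPlane hz ht) hz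
  have e : Li2 = fun w => -∫ t in (0 : ℝ)..1, w * ((1 : ℝ) : ℂ) * logQuot (w * t) := by
    funext w; simp [Li2_eq_integral_logQuot]
  rw [e]
  refine h.neg.congr_deriv (neg_inj.2 ?_)
  rcases eq_or_ne z 0 with h0 | h0
  · simp [h0, logQuot_zero]
  · have := intervalIntegral.integral_eq_sub_of_hasDerivAt (a := (0 : ℝ)) (b := 1)
      (f := fun t : ℝ => Complex.log (1 - z * t) / z)
      (f' := fun t => -((1 : ℝ) : ℂ) / (1 - z * t)) ?_ ?_
    · rw [this, logQuot_of_ne h0]; simp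
    · intro t ht
      rw [Set.uIcc_of_le zero_le_one] at ht
      have hm := mul_mem_cutPlane hz ht
      have h1 : HasDerivAt (fun t : ℝ => 1 - z * t) (-z) t := by
        simpa using ((Complex.ofRealCLM.hasDerivAt (x := t)).const_mul z).const_sub 1
      refine ((h1.clog_real hm).div_const z).congr_deriv ?_
      have := one_sub_ne_zero_of_mem_cutPlane hm
      push_cast
      field_simp
    · refine ContinuousOn.intervalIntegrable ?_
      rw [Set.uIcc_of_le zero_le_one]
      exact ContinuousOn.div (by fun_prop) (by fun_prop)
        fun t ht => one_sub_ne_zero_of_mem_cutPlane (mul_mem_cutPlane hz ht)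

theorem continuousAt_Li2 {z : ℂ} (hz : z ∈ cutPlane) : ContinuousAt Li2 z :=
  (hasDerivAt_Li2 hz).continuousAt

/-! ### Functional equations of the dilogarithm -/

theorem hasDerivAt_Li2_of_ne {z : ℂ} (hz : z ∈ cutPlane) (h0 : z ≠ 0) :
    HasDerivAt Li2 (-(Complex.log (1 - z) / z)) z := by
  rw [← logQuot_of_ne h0]; exact hasDerivAt_Li2 hz

theorem div_sub_one_mem_cutPlane {z : ℂ} (hz : z ∈ cutPlane) : z / (z - 1) ∈ cutPlane := by
  have h1 := one_sub_ne_zero_of_mem_cutPlane hz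
  have h2 : z - 1 ≠ 0 := by rw [← neg_sub]; exact neg_ne_zero.2 h1
  have e : 1 - z / (z - 1) = (1 - z)⁻¹ := by
    field_simp; ring
  rw [cutPlane, Set.mem_ofPred_eq, e]
  rw [Complex.mem_slitPlane_iff_arg, Complex.arg_inv, if_neg (Complex.slitPlane_arg_ne_pi hz)]
  refine ⟨fun h => ?_, inv_ne_zero h1⟩
  have := Complex.neg_pi_lt_arg (1 - z)
  linarith

/-- Landen's identity. -/
theorem Li2_landen {z : ℂ} (hz : z ∈ cutPlane) :
    Li2 z + Li2 (z / (z - 1)) = -(1 / 2) * Complex.log (1 - z) ^ 2 := by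
  let f : ℂ → ℂ := fun w => Li2 w + Li2 (w / (w - 1)) + 1 / 2 * Complex.log (1 - w) ^ 2
  -- The derivative of `f` vanishes on the connected cut plane, and `f` vanishes at 0.
  have hd : ∀ w ∈ cutPlane, HasDerivAt f 0 w := by
    intro w hw
    have h1 := one_sub_ne_zero_of_mem_cutPlane hw
    have h2 : w - 1 ≠ 0 := by rw [← neg_sub]; exact neg_ne_zero.2 h1
    have hq : HasDerivAt (fun w : ℂ => w / (w - 1)) ((1 * (w - 1) - w * 1) / (w - 1) ^ 2) w :=
      (hasDerivAt_id w).div ((hasDerivAt_id w).sub_const 1) h2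
    have hmem := div_sub_one_mem_cutPlane hw
    have hL : HasDerivAt (fun w : ℂ => 1 / 2 * Complex.log (1 - w) ^ 2)
        (1 / 2 * (2 * Complex.log (1 - w) * (-1 / (1 - w)))) w := by
      simpa using ((hasDerivAt_log_one_sub hw).pow 2).const_mul (1 / 2 : ℂ)
    have H := ((hasDerivAt_Li2 hw).add
      (HasDerivAt.comp (h₂ := Li2) w (hasDerivAt_Li2 hmem) hq)).add hL
    refine H.congr_deriv ?_
    rcases eq_or_ne w 0 with h0 | h0
    · subst h0; simp [logQuot_zero]
    · have e : Complex.log (1 - w / (w - 1)) = -Complex.log (1 - w) := by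
        rw [show 1 - w / (w - 1) = (1 - w)⁻¹ by field_simp; ring]
        exact Complex.log_inv _ (Complex.slitPlane_arg_ne_pi hw)
      rw [logQuot_of_ne h0, logQuot_of_ne (div_ne_zero h0 h2), e]
      have h3 : (1 - w) = -(w - 1) := by ring
      rw [show -1 / (1 - w) = 1 / (w - 1) by rw [h3, neg_div_neg_eq]]
      field_simp
      ring
  have hconn : IsPreconnected cutPlane :=
    (starConvex_cutPlane.isPathConnected zero_mem_cutPlane).isConnected.isPreconnected
  have h := isOpen_cutPlane.is_const_of_deriv_eq_zero hconn
    (fun w hw => (hd w hw).differentiableAt.differentiableWithinAt)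
    (fun w hw => (hd w hw).deriv) hz zero_mem_cutPlane
  simp only [f, zero_div, Li2_zero] at h
  simp at h
  linear_combination h

theorem hasSum_Li2 {z : ℂ} (hz : ‖z‖ ≤ 1) :
    HasSum (fun n : ℕ => z ^ (n + 1) / ((n : ℂ) + 1) ^ 2) (Li2 z) := by
  have hint : ∀ n : ℕ, ∫ t in Set.Ioc (0 : ℝ) 1, z ^ (n + 1) / ((n : ℂ) + 1) * (t : ℂ) ^ n
      = z ^ (n + 1) / ((n : ℂ) + 1) ^ 2 := by
    intro n
    have hn : (n : ℂ) + 1 ≠ 0 := by exact_mod_cast n.succ_ne_zero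
    rw [← intervalIntegral.integral_of_le zero_le_one, intervalIntegral.integral_const_mul]
    have : ∫ t in (0 : ℝ)..1, (t : ℂ) ^ n = 1 / ((n : ℂ) + 1) := by
      have h := integral_pow (a := 0) (b := 1) n
      have h' := congrArg (fun x : ℝ => (x : ℂ)) h
      simp only [← intervalIntegral.integral_ofReal] at h'
      push_cast at h'
      rw [h']; simp
    rw [this]; field_simp
  have hnorm : ∀ n : ℕ, ∫ t in Set.Ioc (0 : ℝ) 1, ‖z ^ (n + 1) / ((n : ℂ) + 1) * (t : ℂ) ^ n‖
      = ‖z‖ ^ (n + 1) / ((n : ℝ) + 1) ^ 2 := by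
    intro n
    have hn : (n : ℝ) + 1 ≠ 0 := by exact_mod_cast n.succ_ne_zero
    have e : ∀ t ∈ Set.Ioc (0 : ℝ) 1, ‖z ^ (n + 1) / ((n : ℂ) + 1) * (t : ℂ) ^ n‖
        = ‖z‖ ^ (n + 1) / ((n : ℝ) + 1) * t ^ n := by
      intro t ht
      rw [norm_mul, norm_div, norm_pow, norm_pow, Complex.norm_real, Real.norm_of_nonneg ht.1.le]
      congr 2
      exact_mod_cast Complex.norm_natCast (n + 1)
    rw [MeasureTheory.setIntegral_congr_fun measurableSet_Ioc e,
      ← intervalIntegral.integral_of_le zero_le_one, intervalIntegral.integral_const_mul,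
      integral_pow]
    simp
    field_simp
  have hs : Summable fun n : ℕ => ∫ t in Set.Ioc (0 : ℝ) 1,
      ‖z ^ (n + 1) / ((n : ℂ) + 1) * (t : ℂ) ^ n‖ := by
    simp only [hnorm]
    have h2 : Summable fun n : ℕ => 1 / ((n : ℝ) + 1) ^ 2 := by
      simpa using (summable_nat_add_iff 1).2 (Real.summable_one_div_nat_pow.2 one_lt_two)
    refine Summable.of_nonneg_of_le (fun n => by positivity) (fun n => ?_) h2
    gcongr
    exact pow_le_one₀ (norm_nonneg _) hz
  have H := MeasureTheory.hasSum_integral_of_summable_integral_norm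
    (μ := MeasureTheory.volume.restrict (Set.Ioc (0 : ℝ) 1))
    (F := fun (n : ℕ) (t : ℝ) => z ^ (n + 1) / ((n : ℂ) + 1) * (t : ℂ) ^ n) (fun n => by
      have : Continuous fun t : ℝ => z ^ (n + 1) / ((n : ℂ) + 1) * (t : ℂ) ^ n := by fun_prop
      exact this.integrableOn_Ioc) hs
  simp only [hint] at H
  suffices hLi : Li2 z = ∫ t in Set.Ioc (0 : ℝ) 1,
      ∑' n : ℕ, z ^ (n + 1) / ((n : ℂ) + 1) * (t : ℂ) ^ n by rw [hLi]; exact H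
  -- The endpoint t = 1 is dropped so that |tz| < 1 even when |z| = 1, and the logarithm series
  -- applies.
  rw [Li2, intervalIntegral.integral_of_le zero_le_one, ← MeasureTheory.integral_neg,
    MeasureTheory.integral_Ioc_eq_integral_Ioo, MeasureTheory.integral_Ioc_eq_integral_Ioo]
  refine MeasureTheory.setIntegral_congr_fun measurableSet_Ioo fun t ht => ?_
  have ht0 : (t : ℂ) ≠ 0 := by exact_mod_cast ht.1.ne'
  have hlt : ‖(t : ℂ) * z‖ < 1 := by
    rw [norm_mul, Complex.norm_real, Real.norm_of_nonneg ht.1.le]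
    calc t * ‖z‖ ≤ t * 1 := by gcongr; exact ht.1.le
      _ < 1 := by linarith [ht.2]
  have h := (hasSum_nat_add_iff' (f := fun n : ℕ => ((t : ℂ) * z) ^ n / (n : ℂ)) 1).2
    (Complex.hasSum_taylorSeries_neg_log hlt)
  have h' := h.div_const (t : ℂ)
  simp only [Finset.range_one, Finset.sum_singleton, pow_zero, Nat.cast_zero, div_zero,
    sub_zero] at h'
  have e : (fun n : ℕ => ((t : ℂ) * z) ^ (n + 1) / ((n + 1 : ℕ) : ℂ) / t)
      = fun n : ℕ => z ^ (n + 1) / ((n : ℂ) + 1) * (t : ℂ) ^ n := by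
    funext n
    push_cast
    have hn : (n : ℂ) + 1 ≠ 0 := by exact_mod_cast n.succ_ne_zero
    field_simp
    ring
  rw [e] at h'
  rw [h'.tsum_eq, neg_div]

theorem Li2_one : Li2 1 = (Real.pi : ℂ) ^ 2 / 6 := by
  have h1 := hasSum_Li2 (z := 1) (by simp)
  have h2 := (hasSum_nat_add_iff' (f := fun n : ℕ => (1 : ℝ) / (n : ℝ) ^ 2) 1).2 hasSum_zeta_two
  have h3 := Complex.hasSum_ofReal.2 h2
  refine (h1.unique ?_)
  convert h3 using 1
  · funext n; simp
  · simp

/-- Uniform convergence of the series gives continuity at z = 1, which lies on the cut; the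
reflection formula needs it to fix its constant. -/
theorem continuousOn_Li2_closedBall : ContinuousOn Li2 (Metric.closedBall 0 1) := by
  have h2 : Summable fun n : ℕ => 1 / ((n : ℝ) + 1) ^ 2 := by
    simpa using (summable_nat_add_iff 1).2 (Real.summable_one_div_nat_pow.2 one_lt_two)
  have := continuousOn_tsum (f := fun (n : ℕ) (z : ℂ) => z ^ (n + 1) / ((n : ℂ) + 1) ^ 2)
    (s := Metric.closedBall 0 1) (fun n => by fun_prop) h2 (fun n z hz => by
      rw [norm_div, norm_pow, norm_pow]
      have : ‖(n : ℂ) + 1‖ = (n : ℝ) + 1 := by exact_mod_cast Complex.norm_natCast (n + 1)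
      rw [this]
      gcongr
      exact pow_le_one₀ (norm_nonneg _) (by simpa using hz))
  refine this.congr fun z hz => ?_
  exact (hasSum_Li2 (by simpa using hz)).tsum_eq.symm

/-- Euler's reflection formula. -/
theorem Li2_reflection {z : ℂ} (hz : z ∈ Complex.slitPlane) (hz' : z ∈ cutPlane) :
    Li2 z + Li2 (1 - z)
      = (Real.pi : ℂ) ^ 2 / 6 - Complex.log z * Complex.log (1 - z) := by
  let f : ℂ → ℂ := fun w => Li2 w + Li2 (1 - w) + Complex.log w * Complex.log (1 - w)
  let U : Set ℂ := Complex.slitPlane ∩ cutPlane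
  have hd : ∀ w ∈ U, HasDerivAt f 0 w := by
    rintro w ⟨hw, hw'⟩
    have h1 := one_sub_ne_zero_of_mem_cutPlane hw'
    have h0 := Complex.slitPlane_ne_zero hw
    have hm : 1 - w ∈ cutPlane := by simpa [cutPlane] using hw
    have H := ((hasDerivAt_Li2_of_ne hw' h0).add
      (HasDerivAt.comp (h₂ := Li2) w (hasDerivAt_Li2_of_ne hm h1)
        ((hasDerivAt_id w).const_sub 1))).add
      ((Complex.hasDerivAt_log hw).mul (hasDerivAt_log_one_sub hw'))
    refine H.congr_deriv ?_
    rw [sub_sub_cancel]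
    field_simp
    ring
  have hopen : IsOpen U := Complex.isOpen_slitPlane.inter isOpen_cutPlane
  have hhalf : (1 / 2 : ℂ) ∈ U := by
    constructor
    · left; norm_num
    · left; norm_num
  have hstar : StarConvex ℝ (1 / 2 : ℂ) U := by
    refine StarConvex.inter ?_ ?_
    · have := Complex.starConvex_ofReal_slitPlane (x := 1 / 2) (by norm_num)
      push_cast at this; exact this
    · intro w hw a b ha hb hab
      have h := Complex.starConvex_ofReal_slitPlane (x := 1 / 2) (by norm_num) hw ha hb hab
      rw [cutPlane, Set.mem_ofPred_eq]
      convert h using 1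
      have hab' : (a : ℂ) + b = 1 := by exact_mod_cast hab
      simp only [Complex.real_smul]; push_cast; linear_combination -hab'
  have hconn : IsPreconnected U := (hstar.isPathConnected hhalf).isConnected.isPreconnected
  have hconst : ∀ w ∈ U, f w = f z := fun w hw => hopen.is_const_of_deriv_eq_zero hconn
    (fun w hw => (hd w hw).differentiableAt.differentiableWithinAt)
    (fun w hw => (hd w hw).deriv) hw ⟨hz, hz'⟩
  -- The constant value of `f` is read off as the real variable tends to 0 from the right.
  have hlim1 : Tendsto (fun x : ℝ => f x) (𝓝[>] 0) (𝓝 (f z)) := by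
    refine tendsto_const_nhds.congr' ?_
    filter_upwards [Ioo_mem_nhdsGT (zero_lt_one (α := ℝ))] with x hx
    exact (hconst x ⟨Or.inl (by simpa using hx.1), Or.inl (by simpa using hx.2)⟩).symm
  have hlim2 : Tendsto (fun x : ℝ => f x) (𝓝[>] 0) (𝓝 (Li2 0 + Li2 1 + 0)) := by
    have hx0 : Tendsto (fun x : ℝ => (x : ℂ)) (𝓝[>] 0) (𝓝 0) := by
      have : Continuous fun x : ℝ => (x : ℂ) := by fun_prop
      simpa using (this.tendsto 0).mono_left nhdsWithin_le_nhds
    have hx1 : Tendsto (fun x : ℝ => 1 - (x : ℂ)) (𝓝[>] 0)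
        (𝓝[Metric.closedBall 0 1] 1) := by
      refine tendsto_nhdsWithin_iff.2 ⟨by simpa using hx0.const_sub 1, ?_⟩
      filter_upwards [Ioo_mem_nhdsGT (zero_lt_one (α := ℝ))] with x hx
      have : (1 - (x : ℂ)) = ((1 - x : ℝ) : ℂ) := by push_cast; ring
      rw [this, mem_closedBall_zero_iff, Complex.norm_real, Real.norm_of_nonneg (by linarith [hx.2])]
      linarith [hx.1]
    refine ((((continuousAt_Li2 zero_mem_cutPlane).tendsto.comp hx0).add
      ((continuousOn_Li2_closedBall 1 (by simp)).tendsto.comp hx1))).add ?_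
    -- Here log x · log(1 - x) = (x log x) · `logQuot x`, and the first factor tends to 0.
    have hlog : Tendsto (fun x : ℝ => ((Real.log x * x : ℝ) : ℂ) * logQuot x) (𝓝[>] 0)
        (𝓝 (((0 : ℝ) : ℂ) * logQuot 0)) := by
      refine Tendsto.mul ?_ ?_
      · have h := tendsto_log_mul_rpow_nhdsGT_zero zero_lt_one
        simp only [Real.rpow_one] at h
        exact (Complex.continuous_ofReal.tendsto 0).comp h
      · exact (continuousOn_logQuot.continuousAt
          (isOpen_cutPlane.mem_nhds zero_mem_cutPlane)).tendsto.comp hx0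
    rw [Complex.ofReal_zero, zero_mul] at hlog
    refine hlog.congr' ?_
    filter_upwards [self_mem_nhdsWithin] with x hx
    rw [← mul_logQuot, Complex.ofReal_mul, Complex.ofReal_log (le_of_lt hx)]
    ring
  have := tendsto_nhds_unique hlim1 hlim2
  rw [Li2_zero, Li2_one] at this
  simp only [f] at this
  linear_combination this

/-- The inversion formula. -/
theorem Li2_inversion {z : ℂ} (hz : z.im ≠ 0) :
    Li2 z = -(Real.pi : ℂ) ^ 2 / 6 - 1 / 2 * Complex.log (-z) ^ 2 - Li2 (1 / z) := by
  have hz1 := mem_cutPlane_of_im_ne_zero hz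
  have h1 := one_sub_ne_zero_of_mem_cutPlane hz1
  have h2 : z - 1 ≠ 0 := by rw [← neg_sub]; exact neg_ne_zero.2 h1
  have h0 : z ≠ 0 := by rintro rfl; simp at hz
  have hyim : (1 / (1 - z)).im ≠ 0 := by
    rw [one_div, Complex.inv_im]
    exact div_ne_zero (by simpa using hz) (by simpa using h1)
  have e1 : 1 - 1 / (1 - z) = z / (z - 1) := by
    rw [show (1 - z) = -(z - 1) by ring]; field_simp; ring
  have him : (z / (z - 1)).im ≠ 0 := by rw [← e1]; simpa using hyim
  -- Inversion is the chain z → z/(z - 1) → 1/(1 - z) → 1/z: Landen, reflection, Landen.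
  have hL := Li2_landen hz1
  have hR := Li2_reflection (z := z / (z - 1)) (Or.inr him) (mem_cutPlane_of_im_ne_zero him)
  have hL' := Li2_landen (mem_cutPlane_of_im_ne_zero hyim)
  have e2 : 1 / (1 - z) / (1 / (1 - z) - 1) = 1 / z := by
    rw [show 1 / (1 - z) - 1 = z / (1 - z) by field_simp; ring]; field_simp
  have e3 : 1 - z / (z - 1) = 1 / (1 - z) := by rw [← e1]; ring
  have e4 : Complex.log (1 / (1 - z)) = -Complex.log (1 - z) := by
    rw [one_div]; exact Complex.log_inv _ (Complex.slitPlane_arg_ne_pi hz1)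
  have e5 : Complex.log (z / (z - 1)) = Complex.log (-z) - Complex.log (1 - z) := by
    rw [← log_neg_div_one_sub hz, ← neg_div_neg_eq, neg_sub]
  rw [e1, e2, e5] at hL'
  rw [e3, e4, e5] at hR
  linear_combination hL - hR + hL'

/-! ### The integral `∫₀¹ artanh (x (t - t³)) / t dt` -/

/-- The polynomial `t (1 - t²)`. -/
def hump (t : ℝ) : ℝ := t * (1 - t ^ 2)

theorem continuous_hump : Continuous hump := by unfold hump; fun_prop

theorem hump_neg (t : ℝ) : hump (-t) = -hump t := by unfold hump; ring

theorem hump_sq_le {t : ℝ} (ht : t ∈ Set.Icc (-1 : ℝ) 1) : hump t ^ 2 ≤ 4 / 27 := by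
  have h1 : t ^ 2 ≤ 1 := by nlinarith [ht.1, ht.2]
  -- This product equals 4/27 - (t - t³)²; the maximum is attained at t² = 1/3.
  have h2 : 0 ≤ (4 / 3 - t ^ 2) * (t ^ 2 - 1 / 3) ^ 2 := by
    have := sq_nonneg (t ^ 2 - 1 / 3)
    exact mul_nonneg (by linarith) this
  unfold hump
  linarith [h2, (by ring : (4 / 3 - t ^ 2) * (t ^ 2 - 1 / 3) ^ 2
    = 4 / 27 - (t * (1 - t ^ 2)) ^ 2)]

theorem Icc_zero_one_subset : Set.Icc (0 : ℝ) 1 ⊆ Set.Icc (-1) 1 :=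
  Set.Icc_subset_Icc_left (by norm_num)

/-- The plane without the two real rays `|x| ≥ 3 √3 / 2`. -/
def humpDomain : Set ℂ := {x | x.im ≠ 0 ∨ x.re ^ 2 < 27 / 4}

theorem isOpen_humpDomain : IsOpen humpDomain :=
  (isOpen_ne_fun Complex.continuous_im continuous_const).union
    (isOpen_lt (Complex.continuous_re.pow 2) continuous_const)

theorem neg_mem_humpDomain {x : ℂ} (hx : x ∈ humpDomain) : -x ∈ humpDomain := by
  simpa [humpDomain] using hx

theorem mul_ofReal_mem_cutPlane {x : ℂ} (hx : x ∈ humpDomain) {r : ℝ} (hr : r ^ 2 ≤ 4 / 27) :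
    x * r ∈ cutPlane := by
  rcases eq_or_ne r 0 with h0 | h0
  · simp [h0, zero_mem_cutPlane]
  rcases hx with h | h
  · exact mem_cutPlane_of_im_ne_zero (by simpa using ⟨h, h0⟩)
  · refine mem_cutPlane_of_re_lt_one ?_
    have hr0 : 0 < r ^ 2 := by positivity
    have h1 : (x.re * r) ^ 2 < 1 := by
      rw [mul_pow]
      calc x.re ^ 2 * r ^ 2 < 27 / 4 * r ^ 2 := by gcongr
        _ ≤ 1 := by linarith
    have := (abs_lt.1 ((sq_lt_one_iff_abs_lt_one _).1 h1)).2
    simpa using this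

theorem mul_hump_mem_cutPlane {x : ℂ} (hx : x ∈ humpDomain) {t : ℝ}
    (ht : t ∈ Set.Icc (-1 : ℝ) 1) : x * hump t ∈ cutPlane :=
  mul_ofReal_mem_cutPlane hx (hump_sq_le ht)

theorem neg_mul_hump_mem_cutPlane {x : ℂ} (hx : x ∈ humpDomain) {t : ℝ}
    (ht : t ∈ Set.Icc (-1 : ℝ) 1) : -(x * hump t) ∈ cutPlane := by
  rw [← neg_mul]; exact mul_hump_mem_cutPlane (neg_mem_humpDomain hx) ht

/-- The function `(log (1 + z) - log (1 - z)) / z`, with its removable singularity filled in. -/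
noncomputable def artanhQuot (z : ℂ) : ℂ := -(logQuot z + logQuot (-z))

theorem artanhQuot_neg (z : ℂ) : artanhQuot (-z) = artanhQuot z := by
  simp only [artanhQuot, neg_neg, add_comm]

theorem mul_artanhQuot (z : ℂ) :
    z * artanhQuot z = Complex.log (1 + z) - Complex.log (1 - z) := by
  have h1 := mul_logQuot z
  have h2 := mul_logQuot (-z)
  rw [sub_neg_eq_add] at h2
  rw [artanhQuot, ← h1, ← h2]; ring

theorem hasDerivAt_Li2_sub_Li2_neg {z : ℂ} (hz : z ∈ cutPlane) (hz' : -z ∈ cutPlane) :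
    HasDerivAt (fun w => Li2 w - Li2 (-w)) (artanhQuot z) z := by
  refine ((hasDerivAt_Li2 hz).sub
    (HasDerivAt.comp (h₂ := Li2) z (hasDerivAt_Li2 hz') (hasDerivAt_neg z))).congr_deriv ?_
  rw [artanhQuot]; ring

theorem continuousOn_artanhQuot_hump {x : ℂ} (hx : x ∈ humpDomain) :
    ContinuousOn (fun t : ℝ => artanhQuot (x * hump t)) (Set.Icc (-1) 1) := by
  have hc : Continuous fun t : ℝ => x * (hump t : ℂ) := by
    have := continuous_hump; fun_prop
  exact ((continuousOn_logQuot.comp hc.continuousOn fun t ht => mul_hump_mem_cutPlane hx ht).add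
    (continuousOn_logQuot.comp hc.neg.continuousOn
      fun t ht => neg_mul_hump_mem_cutPlane hx ht)).neg

theorem intervalIntegrable_mul_artanhQuot_hump {x : ℂ} (hx : x ∈ humpDomain) {f : ℝ → ℂ}
    (hf : Continuous f) {a b : ℝ} (ha : a ∈ Set.Icc (-1 : ℝ) 1) (hb : b ∈ Set.Icc (-1 : ℝ) 1) :
    IntervalIntegrable (fun t : ℝ => f t * artanhQuot (x * hump t)) MeasureTheory.volume a b :=
  ContinuousOn.intervalIntegrable
    ((hf.continuousOn.mul (continuousOn_artanhQuot_hump hx)).mono (Set.uIcc_subset_Icc ha hb))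

/-- The integral `∫₀¹ artanh (x (t - t³)) / t dt`. -/
noncomputable def humpIntegral (x : ℂ) : ℂ :=
  1 / 2 * ∫ t in (0 : ℝ)..1, x * (1 - (t : ℂ) ^ 2) * artanhQuot (x * hump t)

theorem humpIntegral_eq (x : ℂ) : humpIntegral x = 1 / 2 * ∫ t in (0 : ℝ)..1,
    (Complex.log (1 + x * hump t) - Complex.log (1 - x * hump t)) / t := by
  rw [humpIntegral]
  congr 1
  refine intervalIntegral.integral_congr_ae (Eventually.of_forall fun t ht => ?_)
  rw [Set.uIoc_of_le zero_le_one] at ht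
  have ht0 : (t : ℂ) ≠ 0 := by exact_mod_cast ht.1.ne'
  rw [← mul_artanhQuot, hump]
  push_cast
  field_simp

/-- The integral splits into two integrals of `logQuot`, at `-x` and at `x`, each differentiable
under the integral sign. -/
theorem continuousAt_humpIntegral {x : ℂ} (hx : x ∈ humpDomain) :
    ContinuousAt humpIntegral x := by
  let k : ℝ → ℝ := fun t => 1 - t ^ 2
  let I : ℂ → ℂ := fun w => ∫ t in (0 : ℝ)..1, w * k t * logQuot (w * hump t)
  have hI : ∀ w ∈ humpDomain, ContinuousAt I w := fun w hw =>
    (hasDerivAt_integral_logQuot continuous_hump (by fun_prop : Continuous k)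
      (fun t => rfl) isOpen_humpDomain
      (fun z hz t ht => mul_hump_mem_cutPlane hz (Icc_zero_one_subset ht)) hw).continuousAt
  have hint : ∀ w ∈ humpDomain, IntervalIntegrable
      (fun t : ℝ => w * k t * logQuot (w * hump t)) MeasureTheory.volume 0 1 := by
    intro w hw
    have hc : Continuous fun t : ℝ => w * (hump t : ℂ) := by
      have := continuous_hump; fun_prop
    refine ContinuousOn.intervalIntegrable ?_
    rw [Set.uIcc_of_le zero_le_one]
    exact ContinuousOn.mul (by fun_prop) (continuousOn_logQuot.comp hc.continuousOn
      fun t ht => mul_hump_mem_cutPlane hw (Icc_zero_one_subset ht))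
  have e : ∀ w ∈ humpDomain, humpIntegral w = 1 / 2 * (I (-w) - I w) := by
    intro w hw
    rw [humpIntegral, ← intervalIntegral.integral_sub (hint _ (neg_mem_humpDomain hw)) (hint _ hw)]
    congr 1
    refine intervalIntegral.integral_congr fun t _ => ?_
    simp only [artanhQuot, k, neg_mul]
    push_cast
    ring
  have hc : ContinuousAt (fun w => 1 / 2 * (I (-w) - I w)) x :=
    continuousAt_const.mul ((ContinuousAt.comp (g := I) (f := fun w : ℂ => -w)
      (hI _ (neg_mem_humpDomain hx)) continuousAt_neg).sub (hI x hx))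
  refine hc.congr ?_
  filter_upwards [isOpen_humpDomain.mem_nhds hx] with w hw
  exact (e w hw).symm

/-- The integrand is the exact derivative of Li₂(x h) - Li₂(-x h) with h = `hump t`, and h vanishes
at both endpoints. -/
theorem integral_deriv_hump_mul_artanhQuot {x : ℂ} (hx : x ∈ humpDomain) :
    ∫ t in (0 : ℝ)..1, x * (1 - 3 * (t : ℂ) ^ 2) * artanhQuot (x * hump t) = 0 := by
  have h := intervalIntegral.integral_eq_sub_of_hasDerivAt (a := (0 : ℝ)) (b := 1)
    (f := fun t : ℝ => Li2 (x * hump t) - Li2 (-(x * hump t)))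
    (f' := fun t : ℝ => x * (1 - 3 * (t : ℂ) ^ 2) * artanhQuot (x * hump t)) ?_ ?_
  · rw [h]; simp [hump]
  · intro t ht
    rw [Set.uIcc_of_le zero_le_one] at ht
    have ht' := Icc_zero_one_subset ht
    have h1 : HasDerivAt hump (1 - 3 * t ^ 2) t := by
      have := (hasDerivAt_id t).mul (((hasDerivAt_id t).pow 2).const_sub 1)
      refine this.congr_deriv ?_
      simp; ring
    have h2 : HasDerivAt (fun t : ℝ => x * (hump t : ℂ)) (x * (1 - 3 * (t : ℂ) ^ 2)) t := by
      have := (h1.ofReal_comp).const_mul x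
      refine this.congr_deriv ?_
      push_cast; ring
    have h3 := HasDerivAt.comp (h₂ := fun w => Li2 w - Li2 (-w)) t (hasDerivAt_Li2_sub_Li2_neg
      (mul_hump_mem_cutPlane hx ht') (neg_mul_hump_mem_cutPlane hx ht')) h2
    refine h3.congr_deriv ?_
    ring
  · exact intervalIntegrable_mul_artanhQuot_hump hx (by fun_prop) (by norm_num) (by norm_num)

/-- With s = 1 - 2t the integrand becomes 2x s(1 + s) m(s), where m is even. On [-1, 1] the odd part
drops out, leaving a multiple of s² m(s). Since 1 - s² = (1 - 3s²) + 2s² and the first summand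
integrates to 0 against m, this is the original integral. -/
theorem integral_hump_one_sub_two_mul {x : ℂ} (hx : x ∈ humpDomain) :
    ∫ t in (0 : ℝ)..1, (Complex.log (1 + x * hump (1 - 2 * t))
      - Complex.log (1 - x * hump (1 - 2 * t))) / t = 2 * humpIntegral x := by
  let m : ℝ → ℂ := fun t => artanhQuot (x * hump t)
  have hint := fun (f : ℝ → ℂ) (hf : Continuous f) (a b : ℝ) ha hb =>
    intervalIntegrable_mul_artanhQuot_hump (a := a) (b := b) hx hf ha hb
  have h1 : ∫ t in (0 : ℝ)..1, (Complex.log (1 + x * hump (1 - 2 * t))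
      - Complex.log (1 - x * hump (1 - 2 * t))) / t
      = ∫ t in (0 : ℝ)..1, (fun s : ℝ => 2 * x * s * (1 + s) * m s) (1 - 2 * t) := by
    refine intervalIntegral.integral_congr_ae (Eventually.of_forall fun t ht => ?_)
    rw [Set.uIoc_of_le zero_le_one] at ht
    have ht0 : (t : ℂ) ≠ 0 := by exact_mod_cast ht.1.ne'
    rw [← mul_artanhQuot]
    simp only [m]
    rw [div_eq_iff ht0]
    have : (hump (1 - 2 * t) : ℂ) = (1 - 2 * t) * (4 * t * (1 - t)) := by
      simp only [hump]; push_cast; ring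
    rw [show x * (hump (1 - 2 * t) : ℂ) * artanhQuot (x * hump (1 - 2 * t))
      = x * ((1 - 2 * t) * (4 * t * (1 - t))) * artanhQuot (x * hump (1 - 2 * t)) by rw [← this]]
    push_cast
    ring
  have h2 : ∫ s in (-1 : ℝ)..1, 2 * x * (s : ℂ) * (1 + s) * m s
      = ∫ s in (0 : ℝ)..1, 4 * x * (s : ℂ) ^ 2 * m s := by
    rw [← intervalIntegral.integral_add_adjacent_intervals (b := 0)
      (hint (fun s => 2 * x * (s : ℂ) * (1 + s)) (by fun_prop) _ _ (by norm_num) (by norm_num))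
      (hint (fun s => 2 * x * (s : ℂ) * (1 + s)) (by fun_prop) _ _ (by norm_num) (by norm_num))]
    have h3 : ∫ s in (-1 : ℝ)..0, 2 * x * (s : ℂ) * (1 + s) * m s
        = ∫ s in (0 : ℝ)..1, 2 * x * (-(s : ℂ)) * (1 - s) * m s := by
      have := intervalIntegral.integral_comp_neg (a := 0) (b := 1)
        (f := fun s : ℝ => 2 * x * (s : ℂ) * (1 + s) * m s)
      rw [neg_zero] at this
      rw [← this]
      refine intervalIntegral.integral_congr fun s _ => ?_
      simp only [m, hump_neg]
      push_cast
      rw [mul_neg x, artanhQuot_neg]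
      ring
    rw [h3]
    rw [← intervalIntegral.integral_add
      (hint (fun s => 2 * x * (-(s : ℂ)) * (1 - s)) (by fun_prop) _ _ (by norm_num) (by norm_num))
      (hint (fun s => 2 * x * (s : ℂ) * (1 + s)) (by fun_prop) _ _ (by norm_num) (by norm_num))]
    refine intervalIntegral.integral_congr fun s _ => ?_
    ring
  have h4 := integral_deriv_hump_mul_artanhQuot hx
  have h5 : ∫ s in (0 : ℝ)..1, x * (1 - (s : ℂ) ^ 2) * m s
      = (∫ s in (0 : ℝ)..1, x * (1 - 3 * (s : ℂ) ^ 2) * m s)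
        + 1 / 2 * ∫ s in (0 : ℝ)..1, 4 * x * (s : ℂ) ^ 2 * m s := by
    rw [← intervalIntegral.integral_const_mul, ← intervalIntegral.integral_add
      (hint (fun s => x * (1 - 3 * (s : ℂ) ^ 2)) (by fun_prop) _ _ (by norm_num) (by norm_num))
      ((hint (fun s => 4 * x * (s : ℂ) ^ 2) (by fun_prop) _ _ (by norm_num)
        (by norm_num)).const_mul _)]
    refine intervalIntegral.integral_congr fun s _ => ?_
    ring
  rw [h1, intervalIntegral.integral_comp_sub_mul (fun s : ℝ => 2 * x * (s : ℂ) * (1 + s) * m s)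
    two_ne_zero 1]
  rw [show (1 : ℝ) - 2 * 1 = -1 by norm_num, show (1 : ℝ) - 2 * 0 = 1 by norm_num]
  simp only [m] at h2 h5 ⊢
  rw [h2, humpIntegral, h5, h4]
  simp only [Complex.real_smul]
  push_cast
  ring

/-! ### Sums of dilogarithms over the roots of a cubic -/

/-- The logarithm of the product equals the sum of the logarithms along [0, 1]: the two sides are
continuous, have equal exponentials, and agree at t = 0. Integrability is part of the conclusion
because two such integrals are subtracted later. -/
theorem Li2_add_three {y₁ y₂ y₃ : ℂ} (h₁ : y₁ ∈ cutPlane) (h₂ : y₂ ∈ cutPlane)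
    (h₃ : y₃ ∈ cutPlane) {P : ℝ → ℂ}
    (hP : ∀ t ∈ Set.Icc (0 : ℝ) 1, (1 - y₁ * t) * (1 - y₂ * t) * (1 - y₃ * t) = P t)
    (hPs : ∀ t ∈ Set.Icc (0 : ℝ) 1, P t ∈ Complex.slitPlane) :
    IntervalIntegrable (fun t : ℝ => Complex.log (P t) / t) MeasureTheory.volume 0 1 ∧
    Li2 y₁ + Li2 y₂ + Li2 y₃ = -∫ t in (0 : ℝ)..1, Complex.log (P t) / t := by
  have hPc : ContinuousOn P (Set.Icc 0 1) := by
    have : Continuous fun t : ℝ => (1 - y₁ * t) * (1 - y₂ * t) * (1 - y₃ * t) := by fun_prop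
    exact this.continuousOn.congr fun t ht => (hP t ht).symm
  have hlc : ∀ y ∈ cutPlane, ContinuousOn (fun t : ℝ => Complex.log (1 - y * t))
      (Set.Icc 0 1) := fun y hy =>
    ContinuousOn.clog (by fun_prop) fun t ht => mul_mem_cutPlane hy ht
  have hlog : ∀ t ∈ Set.Icc (0 : ℝ) 1, Complex.log (P t) = Complex.log (1 - y₁ * t)
      + Complex.log (1 - y₂ * t) + Complex.log (1 - y₃ * t) := by
    intro t ht
    have h := eq_zero_of_exp_eq_one (s := Set.Icc (0 : ℝ) 1) (a := 0) (x := t)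
      (f := fun t => Complex.log (P t) - (Complex.log (1 - y₁ * t)
      + Complex.log (1 - y₂ * t) + Complex.log (1 - y₃ * t))) isPreconnected_Icc
      ((hPc.clog hPs).sub (((hlc _ h₁).add (hlc _ h₂)).add (hlc _ h₃))) ?_ (by simp) ?_ ht
    · exact sub_eq_zero.1 h
    · intro s hs
      rw [Complex.exp_sub, Complex.exp_add, Complex.exp_add,
        Complex.exp_log (Complex.slitPlane_ne_zero (hPs s hs)),
        Complex.exp_log (one_sub_ne_zero_of_mem_cutPlane (mul_mem_cutPlane h₁ hs)),
        Complex.exp_log (one_sub_ne_zero_of_mem_cutPlane (mul_mem_cutPlane h₂ hs)),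
        Complex.exp_log (one_sub_ne_zero_of_mem_cutPlane (mul_mem_cutPlane h₃ hs)), hP s hs,
        div_self (Complex.slitPlane_ne_zero (hPs s hs))]
    · simp [← hP 0 (by simp)]
  have hint : ∀ y ∈ cutPlane, IntervalIntegrable (fun t : ℝ => y * logQuot (y * t))
      MeasureTheory.volume 0 1 := by
    intro y hy
    refine ContinuousOn.intervalIntegrable ?_
    rw [Set.uIcc_of_le zero_le_one]
    exact continuousOn_const.mul (continuousOn_logQuot.comp (by fun_prop)
      fun t ht => mul_mem_cutPlane hy ht)
  have heq : ∀ t ∈ Set.uIoc (0 : ℝ) 1, y₁ * logQuot (y₁ * t) + y₂ * logQuot (y₂ * t)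
      + y₃ * logQuot (y₃ * t) = Complex.log (P t) / t := by
    intro t ht
    rw [Set.uIoc_of_le zero_le_one] at ht
    have ht0 : (t : ℂ) ≠ 0 := by exact_mod_cast ht.1.ne'
    rw [hlog t ⟨ht.1.le, ht.2⟩, ← mul_logQuot, ← mul_logQuot, ← mul_logQuot]
    field_simp
  have hsum := ((hint _ h₁).add (hint _ h₂)).add (hint _ h₃)
  refine ⟨hsum.congr heq, ?_⟩
  rw [← intervalIntegral.integral_congr_ae (Eventually.of_forall heq),
    intervalIntegral.integral_add ((hint _ h₁).add (hint _ h₂)) (hint _ h₃),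
    intervalIntegral.integral_add (hint _ h₁) (hint _ h₂), Li2_eq_integral_logQuot,
    Li2_eq_integral_logQuot, Li2_eq_integral_logQuot]
  ring

/-- The numbers `w₁, w₂, w₃` are the roots of `w³ - w = 1 / x`. -/
structure IsRootTriple (x w₁ w₂ w₃ : ℂ) : Prop where
  sum : w₁ + w₂ + w₃ = 0
  sum_mul : w₁ * w₂ + w₁ * w₃ + w₂ * w₃ = -1
  mul_prod : x * (w₁ * w₂ * w₃) = 1

theorem IsRootTriple.mul_cubic {x w₁ w₂ w₃ : ℂ} (h : IsRootTriple x w₁ w₂ w₃) :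
    x * (w₁ ^ 3 - w₁) = 1 ∧ x * (w₂ ^ 3 - w₂) = 1 ∧ x * (w₃ ^ 3 - w₃) = 1 := by
  obtain ⟨h1, h2, h3⟩ := h
  refine ⟨?_, ?_, ?_⟩
  · linear_combination h3 + x * w₁ ^ 2 * h1 - x * w₁ * h2
  · linear_combination h3 + x * w₂ ^ 2 * h1 - x * w₂ * h2
  · linear_combination h3 + x * w₃ ^ 2 * h1 - x * w₃ * h2

/-- By Vieta, 1 ± x(t - t³) is the product of the factors 1 ∓ t/w over the three roots. -/
theorem sum_Li2_inv_roots {x w₁ w₂ w₃ : ℂ} (h : IsRootTriple x w₁ w₂ w₃)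
    (hx : x ∈ humpDomain) (h₁ : 1 / w₁ ∈ cutPlane ∧ -1 / w₁ ∈ cutPlane)
    (h₂ : 1 / w₂ ∈ cutPlane ∧ -1 / w₂ ∈ cutPlane) (h₃ : 1 / w₃ ∈ cutPlane ∧ -1 / w₃ ∈ cutPlane) :
    (Li2 (-1 / w₁) + Li2 (-1 / w₂) + Li2 (-1 / w₃))
      - (Li2 (1 / w₁) + Li2 (1 / w₂) + Li2 (1 / w₃)) = 2 * humpIntegral x := by
  obtain ⟨e1, e2, e3⟩ := h
  have hx0 : x ≠ 0 := by rintro rfl; simp at e3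
  have hw : w₁ * w₂ * w₃ ≠ 0 := by intro h; simp [h] at e3
  have hw1 : w₁ ≠ 0 := by rintro rfl; simp at hw
  have hw2 : w₂ ≠ 0 := by rintro rfl; simp at hw
  have hw3 : w₃ ≠ 0 := by rintro rfl; simp at hw
  have hxw : x = 1 / (w₁ * w₂ * w₃) := by rw [eq_div_iff hw]; exact e3
  obtain ⟨i1, q1⟩ := Li2_add_three h₁.1 h₂.1 h₃.1 (P := fun t => 1 + x * hump t)
    (fun t ht => by
      rw [hxw, hump]; push_cast; field_simp
      linear_combination (t : ℂ) ^ 2 * e1 - t * e2)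
    (fun t ht => by
      simpa [cutPlane] using neg_mul_hump_mem_cutPlane hx (Icc_zero_one_subset ht))
  obtain ⟨i2, q2⟩ := Li2_add_three h₁.2 h₂.2 h₃.2 (P := fun t => 1 - x * hump t)
    (fun t ht => by
      rw [hxw, hump]; push_cast; field_simp
      linear_combination (t : ℂ) ^ 2 * e1 + t * e2)
    (fun t ht => mul_hump_mem_cutPlane hx (Icc_zero_one_subset ht))
  rw [q1, q2, humpIntegral_eq]
  simp only [sub_div]
  rw [intervalIntegral.integral_sub i1 i2]
  ring

/-- With s = 1 - 2t one has 1 - 2t/(1 + w) = (w + s)/(1 + w). Over the roots, ∏(w + s) = 1/x + s³ -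
s and ∏(1 + w) = 1/x, so the product is 1 - x(s - s³). Non-real roots keep every 2/(1 ± w) off the
cut. -/
theorem sum_Li2_two_div_roots {x w₁ w₂ w₃ : ℂ} (h : IsRootTriple x w₁ w₂ w₃)
    (hx : x.im ≠ 0) (h₁ : w₁.im ≠ 0) (h₂ : w₂.im ≠ 0) (h₃ : w₃.im ≠ 0) :
    (Li2 (2 / (1 + w₁)) + Li2 (2 / (1 + w₂)) + Li2 (2 / (1 + w₃)))
      - (Li2 (2 / (1 - w₁)) + Li2 (2 / (1 - w₂)) + Li2 (2 / (1 - w₃)))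
      = 2 * humpIntegral x := by
  obtain ⟨e1, e2, e3⟩ := h
  have hx' : x ∈ humpDomain := Or.inl hx
  have hw : w₁ * w₂ * w₃ ≠ 0 := by intro h; simp [h] at e3
  have hp : ∀ w : ℂ, w.im ≠ 0 → 1 + w ≠ 0 := fun w hw h => hw (by
    rw [eq_neg_of_add_eq_zero_right h]; simp)
  have hm : ∀ w : ℂ, w.im ≠ 0 → 1 - w ≠ 0 := fun w hw h => hw (by
    rw [← sub_eq_zero.1 h]; simp)
  have him : ∀ w : ℂ, w.im ≠ 0 → 2 / w ∈ cutPlane := fun w hw => by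
    refine mem_cutPlane_of_im_ne_zero ?_
    have hw0 : w ≠ 0 := by rintro rfl; simp at hw
    rw [Complex.div_im]
    simpa using ⟨hw, hw0⟩
  have hp1 := hp _ h₁
  have hp2 := hp _ h₂
  have hp3 := hp _ h₃
  have hm1 := hm _ h₁
  have hm2 := hm _ h₂
  have hm3 := hm _ h₃
  have hpp : (1 + w₁) * (1 + w₂) * (1 + w₃) = w₁ * w₂ * w₃ := by linear_combination e1 + e2
  have hmm : (1 - w₁) * (1 - w₂) * (1 - w₃) = -(w₁ * w₂ * w₃) := by linear_combination -e1 + e2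
  have hIcc : ∀ t ∈ Set.Icc (0 : ℝ) 1, 1 - 2 * t ∈ Set.Icc (-1 : ℝ) 1 := fun t ht =>
    ⟨by linarith [ht.2], by linarith [ht.1]⟩
  obtain ⟨i1, q1⟩ := Li2_add_three (him (1 + w₁) (by simpa)) (him (1 + w₂) (by simpa))
    (him (1 + w₃) (by simpa)) (P := fun t => 1 - x * hump (1 - 2 * t))
    (fun t ht => by
      have : (1 - 2 / (1 + w₁) * (t : ℂ)) * (1 - 2 / (1 + w₂) * t) * (1 - 2 / (1 + w₃) * t)
          = (1 + w₁ - 2 * t) * (1 + w₂ - 2 * t) * (1 + w₃ - 2 * t)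
            / ((1 + w₁) * (1 + w₂) * (1 + w₃)) := by field_simp
      rw [this, hpp, hump, div_eq_iff hw]
      push_cast
      linear_combination (1 - 2 * (t : ℂ)) ^ 2 * e1 + (1 - 2 * (t : ℂ)) * e2
        + (1 - 2 * (t : ℂ)) * (1 - (1 - 2 * (t : ℂ)) ^ 2) * e3)
    (fun t ht => mul_hump_mem_cutPlane hx' (hIcc t ht))
  obtain ⟨i2, q2⟩ := Li2_add_three (him (1 - w₁) (by simpa)) (him (1 - w₂) (by simpa))
    (him (1 - w₃) (by simpa)) (P := fun t => 1 + x * hump (1 - 2 * t))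
    (fun t ht => by
      have : (1 - 2 / (1 - w₁) * (t : ℂ)) * (1 - 2 / (1 - w₂) * t) * (1 - 2 / (1 - w₃) * t)
          = (1 - w₁ - 2 * t) * (1 - w₂ - 2 * t) * (1 - w₃ - 2 * t)
            / ((1 - w₁) * (1 - w₂) * (1 - w₃)) := by field_simp
      rw [this, hmm, hump, div_eq_iff (neg_ne_zero.2 hw)]
      push_cast
      linear_combination -(1 - 2 * (t : ℂ)) ^ 2 * e1 + (1 - 2 * (t : ℂ)) * e2
        + (1 - 2 * (t : ℂ)) * (1 - (1 - 2 * (t : ℂ)) ^ 2) * e3)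
    (fun t ht => by
      simpa [cutPlane] using neg_mul_hump_mem_cutPlane hx' (hIcc t ht))
  rw [q1, q2, ← integral_hump_one_sub_two_mul hx']
  simp only [sub_div]
  rw [intervalIntegral.integral_sub i2 i1]
  ring

/-! ### The moments of `t ↦ t` and `t ↦ 1 - t²` on the unit interval -/

/-- The integral `∫₀¹ tᵃ (1 - t²)ᵇ dt`. -/
noncomputable def humpMoment (a b : ℕ) : ℝ := ∫ t in (0 : ℝ)..1, t ^ a * (1 - t ^ 2) ^ b

theorem humpMoment_nonneg (a b : ℕ) : 0 ≤ humpMoment a b :=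
  intervalIntegral.integral_nonneg zero_le_one fun t ht =>
    mul_nonneg (pow_nonneg ht.1 _) (pow_nonneg (by nlinarith [ht.1, ht.2]) _)

theorem humpMoment_succ_right_eq_sub (a b : ℕ) :
    humpMoment a (b + 1) = humpMoment a b - humpMoment (a + 2) b := by
  rw [humpMoment, humpMoment, humpMoment, ← intervalIntegral.integral_sub
    (Continuous.intervalIntegrable (by fun_prop) _ _)
    (Continuous.intervalIntegrable (by fun_prop) _ _)]
  refine intervalIntegral.integral_congr fun t _ => ?_
  ring

/-- The function tᵃ⁺¹(1 - t²)ᵇ⁺¹ vanishes at both ends, so its derivative integrates to 0. -/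
theorem humpMoment_by_parts (a b : ℕ) :
    (a + 1) * humpMoment a (b + 1) = 2 * (b + 1) * humpMoment (a + 2) b := by
  have h := intervalIntegral.integral_eq_sub_of_hasDerivAt (a := (0 : ℝ)) (b := 1)
    (f := fun t : ℝ => t ^ (a + 1) * (1 - t ^ 2) ^ (b + 1))
    (f' := fun t : ℝ => (a + 1) * (t ^ a * (1 - t ^ 2) ^ (b + 1))
      - 2 * (b + 1) * (t ^ (a + 2) * (1 - t ^ 2) ^ b)) ?_
      (Continuous.intervalIntegrable (by fun_prop) _ _)
  · rw [intervalIntegral.integral_sub (Continuous.intervalIntegrable (by fun_prop) _ _)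
      (Continuous.intervalIntegrable (by fun_prop) _ _),
      intervalIntegral.integral_const_mul, intervalIntegral.integral_const_mul] at h
    rw [humpMoment, humpMoment]
    simp at h
    linarith
  · intro t _
    have h1 := ((hasDerivAt_id t).pow (a + 1)).mul
      ((((hasDerivAt_id t).pow 2).const_sub 1).pow (b + 1))
    refine h1.congr_deriv ?_
    simp
    ring

theorem humpMoment_succ_right (a b : ℕ) :
    (a + 2 * b + 3) * humpMoment a (b + 1) = 2 * (b + 1) * humpMoment a b := by
  have h1 := humpMoment_by_parts a b
  have h2 := humpMoment_succ_right_eq_sub a b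
  linear_combination h1 + 2 * (b + 1 : ℝ) * h2

theorem humpMoment_add_two_left (a b : ℕ) :
    (a + 2 * b + 3) * humpMoment (a + 2) b = (a + 1) * humpMoment a b := by
  have h1 := humpMoment_by_parts a b
  have h2 := humpMoment_succ_right_eq_sub a b
  linear_combination -h1 + (a + 1 : ℝ) * h2

/-- The integral `∫₀¹ t²ⁿ (1 - t²)²ⁿ⁺¹ dt`. -/
noncomputable def diagMoment (n : ℕ) : ℝ := humpMoment (2 * n) (2 * n + 1)

theorem diagMoment_nonneg (n : ℕ) : 0 ≤ diagMoment n := humpMoment_nonneg _ _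

theorem diagMoment_zero : diagMoment 0 = 2 / 3 := by
  rw [diagMoment, humpMoment]
  simp
  norm_num

/-- One step on the left index and two on the right give the factors 6n + 5, 6n + 7 and 6n + 9; the
last is 3(2n + 3) and cancels against 2(2n + 3). -/
theorem diagMoment_succ (n : ℕ) :
    3 * ((6 * n + 5) * (6 * n + 7)) * diagMoment (n + 1)
      = 4 * ((2 * n + 1) * (2 * n + 2)) * diagMoment n := by
  have h1 := humpMoment_add_two_left (2 * n) (2 * n + 1)
  have h2 := humpMoment_succ_right (2 * n + 2) (2 * n + 1)
  have h3 := humpMoment_succ_right (2 * n + 2) (2 * n + 2)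
  rw [diagMoment, diagMoment, show 2 * (n + 1) = 2 * n + 2 by ring]
  push_cast at h1 h2 h3 ⊢
  have hn : (2 * (n : ℝ) + 3) ≠ 0 := by positivity
  have e : (2 * (n : ℝ) + 3) * (3 * ((6 * n + 5) * (6 * n + 7)) * humpMoment (2 * n + 2) (2 * n + 2 + 1)
      - 4 * ((2 * n + 1) * (2 * n + 2)) * humpMoment (2 * n) (2 * n + 1)) = 0 := by
    linear_combination (2 * (n : ℝ) + 3) * 4 * (2 * n + 2) * h1
      + (2 * (n : ℝ) + 3) * (2 * (6 * n + 5)) * h2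
      + (6 * n + 5) * (6 * n + 7) * h3
  exact sub_eq_zero.1 ((mul_eq_zero.1 e).resolve_left hn)

theorem diagMoment_pos (n : ℕ) : 0 < diagMoment n := by
  induction n with
  | zero => rw [diagMoment_zero]; norm_num
  | succ n ih =>
    have h := diagMoment_succ n
    have h2 : 0 < 4 * ((2 * (n : ℝ) + 1) * (2 * n + 2)) * diagMoment n := by positivity
    rw [← h] at h2
    exact pos_of_mul_pos_right h2 (by positivity)

/-- The moments decay like (4/27)ⁿ n^(-1/2). The squared bound makes the induction step a polynomial
inequality. -/
theorem diagMoment_sq_le (n : ℕ) : ((27 / 4) ^ n * diagMoment n) ^ 2 * (n + 1) ≤ 1 := by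
  induction n with
  | zero => rw [diagMoment_zero]; norm_num
  | succ n ih =>
    set D : ℝ := (27 / 4) ^ n * diagMoment n with hD
    have hr : (27 / 4 : ℝ) ^ (n + 1) * diagMoment (n + 1)
        = 9 * ((2 * n + 1) * (2 * n + 2)) / ((6 * n + 5) * (6 * n + 7)) * D := by
      have h := diagMoment_succ n
      rw [div_mul_eq_mul_div, eq_div_iff (by positivity), hD, pow_succ]
      linear_combination (27 / 4 : ℝ) ^ n * (9 / 4) * h
    rw [hr, mul_pow, div_pow, div_mul_eq_mul_div, div_mul_eq_mul_div, div_le_one (by positivity)]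
    have key : (9 * ((2 * (n : ℝ) + 1) * (2 * n + 2))) ^ 2 * (n + 2)
        ≤ ((6 * n + 5) * (6 * n + 7)) ^ 2 * (n + 1) := by
      have hn : (0 : ℝ) ≤ n := n.cast_nonneg
      nlinarith [pow_nonneg hn 2, pow_nonneg hn 3, pow_nonneg hn 4, pow_nonneg hn 5]
    have hn1 : (0 : ℝ) < n + 1 := by positivity
    refine le_of_mul_le_mul_right ?_ hn1
    push_cast
    calc (9 * ((2 * (n : ℝ) + 1) * (2 * n + 2))) ^ 2 * D ^ 2 * ((n : ℝ) + 1 + 1) * ((n : ℝ) + 1)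
        = ((9 * ((2 * (n : ℝ) + 1) * (2 * n + 2))) ^ 2 * ((n : ℝ) + 2)) * (D ^ 2 * ((n : ℝ) + 1)) := by ring
      _ ≤ (((6 * (n : ℝ) + 5) * (6 * n + 7)) ^ 2 * ((n : ℝ) + 1)) * 1 := by gcongr
      _ = _ := by ring

/-- The extra factor 1/(2n + 1) yields decay of order n^(-3/2), hence absolute convergence on the
whole circle |x|² = 27/4. -/
theorem diagMoment_le (n : ℕ) :
    (27 / 4) ^ n * diagMoment n / (2 * n + 1) ≤ 1 / ((n : ℝ) + 1) ^ (3 / 2 : ℝ) := by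
  have hn1 : (0 : ℝ) < n + 1 := by positivity
  have h := diagMoment_sq_le n
  have h0 : 0 ≤ (27 / 4) ^ n * diagMoment n := mul_nonneg (by positivity) (diagMoment_nonneg n)
  have hs : (27 / 4) ^ n * diagMoment n * √((n : ℝ) + 1) ≤ 1 := by
    refine abs_le_one_iff_mul_self_le_one.2 ?_ |> (le_abs_self _).trans
    nlinarith [Real.mul_self_sqrt hn1.le]
  have e : ((n : ℝ) + 1) ^ (3 / 2 : ℝ) = (n + 1) * √((n : ℝ) + 1) := by
    rw [Real.sqrt_eq_rpow, show (3 / 2 : ℝ) = 1 + 1 / 2 by norm_num, Real.rpow_add hn1,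
      Real.rpow_one]
  rw [e, div_le_div_iff₀ (by positivity) (by positivity)]
  have hsq := Real.sqrt_nonneg ((n : ℝ) + 1)
  nlinarith [(n.cast_nonneg : (0 : ℝ) ≤ n)]

theorem summable_inv_succ_rpow : Summable fun n : ℕ => 1 / ((n : ℝ) + 1) ^ (3 / 2 : ℝ) := by
  have h := (summable_nat_add_iff 1).2
    (Real.summable_one_div_nat_rpow.2 (by norm_num : (1 : ℝ) < 3 / 2))
  simpa using h

/-! ### The hypergeometric series -/

theorem poch_zero (a : ℂ) : poch a 0 = 1 := by simp [poch]

theorem poch_succ (a : ℂ) (n : ℕ) : poch a (n + 1) = poch a n * (a + n) := by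
  simp [poch, ascPochhammer_succ_right, Polynomial.eval_add]

theorem poch_ofReal_ne_zero {a : ℝ} (ha : 0 < a) (n : ℕ) : poch a n ≠ 0 := by
  induction n with
  | zero => simp [poch_zero]
  | succ n ih =>
    rw [poch_succ]
    refine mul_ne_zero ih ?_
    have : a + n ≠ 0 := by positivity
    exact_mod_cast this

theorem poch_half_mul (n : ℕ) : poch (1 / 2) n * (2 * n + 1) = poch (3 / 2) n := by
  induction n with
  | zero => simp [poch_zero]
  | succ n ih => rw [poch_succ, poch_succ, ← ih]; push_cast; ring

theorem diagMoment_eq_poch (n : ℕ) :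
    3 / 2 * (diagMoment n : ℂ) * (poch (5 / 6) n * poch (7 / 6) n)
      = (4 / 27) ^ n * (poch (1 / 2) n * poch 1 n) := by
  induction n with
  | zero => simp [poch_zero, diagMoment_zero]
  | succ n ih =>
    have h : 3 * ((6 * n + 5) * (6 * n + 7)) * (diagMoment (n + 1) : ℂ)
      = 4 * ((2 * n + 1) * (2 * n + 2)) * (diagMoment n : ℂ) := by
      exact_mod_cast congrArg (fun r : ℝ => (r : ℂ)) (diagMoment_succ n)
    simp only [poch_succ, pow_succ]
    linear_combination (1 / 72 : ℂ) * (poch (5 / 6) n * poch (7 / 6) n) * h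
      + 4 / 27 * (1 / 2 + n) * (1 + n) * ih

theorem s3Term_eq (u : ℂ) (n : ℕ) :
    s3Term u n = 3 / 2 * ((1 / (u * (u ^ 2 - 1))) ^ (2 * n) / (2 * n + 1) * diagMoment n) := by
  have h56 := poch_ofReal_ne_zero (a := 5 / 6) (by norm_num) n
  have h76 := poch_ofReal_ne_zero (a := 7 / 6) (by norm_num) n
  have h12 := poch_ofReal_ne_zero (a := 1 / 2) (by norm_num) n
  push_cast at h56 h76 h12
  have hn : (2 * (n : ℂ) + 1) ≠ 0 := by exact_mod_cast (by positivity : (2 * n + 1 : ℕ) ≠ 0)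
  have h := diagMoment_eq_poch n
  rw [s3Term, ← poch_half_mul]
  rw [show ((1 / (u * (u ^ 2 - 1))) ^ (2 * n) * (4 / 27) ^ n *
    ((poch (1 / 2) n * poch (1 / 2) n * poch 1 n) /
      (poch (5 / 6) n * poch (7 / 6) n * (poch (1 / 2) n * (2 * n + 1)))))
    = (1 / (u * (u ^ 2 - 1))) ^ (2 * n) / (2 * n + 1) * ((4 / 27) ^ n * (poch (1 / 2) n * poch 1 n))
      / (poch (5 / 6) n * poch (7 / 6) n) by field_simp, ← h]
  field_simp

theorem norm_s3Term (u : ℂ) (n : ℕ) : ‖s3Term u n‖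
    = 3 / 2 * ((‖1 / (u * (u ^ 2 - 1))‖ ^ 2) ^ n * diagMoment n / (2 * n + 1)) := by
  have hn : ‖(2 * (n : ℂ) + 1)‖ = 2 * n + 1 := by
    exact_mod_cast Complex.norm_natCast (2 * n + 1)
  rw [s3Term_eq, norm_mul, norm_mul, norm_div (_ ^ _), hn, norm_pow, Complex.norm_real,
    Real.norm_of_nonneg (diagMoment_nonneg n), pow_mul]
  norm_num
  ring

theorem norm_s3Term_le {u : ℂ} (hu : ‖1 / (u * (u ^ 2 - 1))‖ ^ 2 ≤ 27 / 4) (n : ℕ) :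
    ‖s3Term u n‖ ≤ 3 / 2 * (1 / ((n : ℝ) + 1) ^ (3 / 2 : ℝ)) := by
  rw [norm_s3Term]
  have := diagMoment_nonneg n
  refine mul_le_mul_of_nonneg_left ?_ (by norm_num)
  refine le_trans ?_ (diagMoment_le n)
  gcongr

theorem s3Converges_iff (u : ℂ) :
    S3Converges u ↔ u * (u ^ 2 - 1) ≠ 0 ∧ ‖1 / (u * (u ^ 2 - 1))‖ ^ 2 ≤ 27 / 4 := by
  refine ⟨fun h => ⟨h.1, ?_⟩, fun h => ⟨h.1, ?_⟩⟩
  · by_contra! hlt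
    -- The moment ratio tends to 4/27, so the ratio of norms tends to |x|² · 4/27 > 1.
    refine not_summable_of_ratio_test_tendsto_gt_one (f := s3Term u)
      (l := ‖1 / (u * (u ^ 2 - 1))‖ ^ 2 * (4 / 27)) (by linarith) ?_ h.2
    set y := ‖1 / (u * (u ^ 2 - 1))‖ ^ 2
    have hy : y ≠ 0 := by linarith
    have e : (fun n => ‖s3Term u (n + 1)‖ / ‖s3Term u n‖) = fun n : ℕ =>
        y * (4 / 3 * ((1 + 2 * (n : ℝ)) / (5 + 6 * n) * ((2 + 2 * (n : ℝ)) / (7 + 6 * n)))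
          * ((1 + 2 * (n : ℝ)) / (3 + 2 * n))) := by
      funext n
      have h1 := diagMoment_pos n
      have h2 : diagMoment (n + 1) = 4 * ((2 * n + 1) * (2 * n + 2)) * diagMoment n
          / (3 * ((6 * n + 5) * (6 * n + 7))) := by
        rw [eq_div_iff (by positivity), ← diagMoment_succ]; ring
      rw [norm_s3Term, norm_s3Term, h2]
      push_cast
      change 3 / 2 * (y ^ (n + 1) * _ / _) / (3 / 2 * (y ^ n * _ / _)) = _
      have h3 : 5 + 6 * (n : ℝ) ≠ 0 := by positivity
      have h4 : 7 + 6 * (n : ℝ) ≠ 0 := by positivity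
      have h5 : 3 + 2 * (n : ℝ) ≠ 0 := by positivity
      rw [show 6 * (n : ℝ) + 5 = 5 + 6 * n by ring, show 6 * (n : ℝ) + 7 = 7 + 6 * n by ring,
        show 2 * ((n : ℝ) + 1) + 1 = 3 + 2 * n by ring]
      field_simp
      ring
    rw [e]
    have l1 := tendsto_add_mul_div_add_mul_atTop_nhds (1 : ℝ) 5 2 (d := 6) (by norm_num)
    have l2 := tendsto_add_mul_div_add_mul_atTop_nhds (2 : ℝ) 7 2 (d := 6) (by norm_num)
    have l3 := tendsto_add_mul_div_add_mul_atTop_nhds (1 : ℝ) 3 2 (d := 2) (by norm_num)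
    convert (((l1.mul l2).const_mul (4 / 3)).mul l3).const_mul y using 2
    norm_num
  · exact Summable.of_norm_bounded (summable_inv_succ_rpow.mul_left _) (norm_s3Term_le h.2)

/-- The summable bound is uniform over the convergence set, including its boundary, where the double
roots u² = 1/3 and u² = 4/3 lie. -/
theorem continuousOn_s3 : ContinuousOn s3 {u | S3Converges u} := by
  have hne : ∀ u ∈ {u | S3Converges u}, u * (u ^ 2 - 1) ≠ 0 := fun u hu => hu.1
  unfold s3
  refine ContinuousOn.mul (ContinuousOn.div (by fun_prop) (by fun_prop) fun u hu => ?_)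
    (continuousOn_tsum (fun n => ?_) (summable_inv_succ_rpow.mul_left (3 / 2))
      fun n u hu => norm_s3Term_le ((s3Converges_iff u).1 hu).2 n)
  · rw [mul_assoc]; exact mul_ne_zero (by norm_num) (hne u hu)
  · unfold s3Term
    have : ContinuousOn (fun u : ℂ => 1 / (u * (u ^ 2 - 1))) {u | S3Converges u} :=
      ContinuousOn.div (by fun_prop) (by fun_prop) hne
    exact ((this.pow _).mul continuousOn_const).mul continuousOn_const

theorem hasSum_log_one_add_sub_log_one_sub {z : ℂ} (hz : ‖z‖ < 1) :
    HasSum (fun n : ℕ => 2 * (z ^ (2 * n + 1) / (2 * n + 1)))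
      (Complex.log (1 + z) - Complex.log (1 - z)) := by
  have h := (Complex.hasSum_taylorSeries_log hz).add (Complex.hasSum_taylorSeries_neg_log hz)
  rw [← sub_eq_add_neg] at h
  have hinj : Function.Injective fun n : ℕ => 2 * n + 1 := fun a b hab => by
    simp only at hab; omega
  have h' := (hinj.hasSum_iff fun m hm => ?_).2 h
  · convert h' using 1
    funext n
    simp only [Function.comp_apply]
    rw [show (-1 : ℂ) ^ (2 * n + 1 + 1) = 1 from Even.neg_one_pow ⟨n + 1, by ring⟩]
    push_cast
    ring
  · have hm' : Even m := by
      by_contra hodd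
      obtain ⟨k, hk⟩ := Nat.not_even_iff_odd.1 hodd
      exact hm ⟨k, hk.symm⟩
    rw [hm'.add_one.neg_one_pow]
    ring

theorem s3_eq_humpIntegral {u : ℂ} (hu : S3Converges u) :
    s3 u = humpIntegral (1 / (u * (u ^ 2 - 1))) := by
  have hx2 := ((s3Converges_iff u).1 hu).2
  have hsum := hu.2
  have hs3 : s3 u = ∑' n, 2 / 3 * (1 / (u * (u ^ 2 - 1))) * s3Term u n := by
    rw [tsum_mul_left, s3]
    congr 1
    rw [mul_assoc 3, ← div_div]; ring
  set x := 1 / (u * (u ^ 2 - 1)) with hx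
  let F : ℕ → ℝ → ℂ := fun n t =>
    x ^ (2 * n + 1) / (2 * n + 1) * ((t ^ (2 * n) * (1 - t ^ 2) ^ (2 * n + 1) : ℝ) : ℂ)
  have hint : ∀ n, ∫ t in Set.Ioc (0 : ℝ) 1, F n t = 2 / 3 * x * s3Term u n := by
    intro n
    rw [← intervalIntegral.integral_of_le zero_le_one, intervalIntegral.integral_const_mul,
      intervalIntegral.integral_ofReal, s3Term_eq, ← hx]
    change _ * (diagMoment n : ℂ) = _
    ring
  have hnorm : ∀ n, ∫ t in Set.Ioc (0 : ℝ) 1, ‖F n t‖ = ‖2 / 3 * x * s3Term u n‖ := by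
    intro n
    have hpt : ∀ t ∈ Set.Ioc (0 : ℝ) 1, ‖F n t‖
        = ‖x ^ (2 * n + 1) / (2 * n + 1)‖ * (t ^ (2 * n) * (1 - t ^ 2) ^ (2 * n + 1)) := by
      intro t ht
      have : 0 ≤ t ^ (2 * n) * (1 - t ^ 2) ^ (2 * n + 1) :=
        mul_nonneg (pow_nonneg ht.1.le _) (pow_nonneg (by nlinarith [ht.1, ht.2]) _)
      simp only [F]
      rw [norm_mul, Complex.norm_real, Real.norm_of_nonneg this]
    rw [MeasureTheory.setIntegral_congr_fun measurableSet_Ioc hpt,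
      ← intervalIntegral.integral_of_le zero_le_one, intervalIntegral.integral_const_mul]
    change _ * diagMoment n = _
    rw [s3Term_eq, ← hx, show 2 / 3 * x * (3 / 2 * (x ^ (2 * n) / (2 * n + 1) * diagMoment n))
      = x ^ (2 * n + 1) / (2 * n + 1) * diagMoment n by ring, norm_mul, Complex.norm_real,
      Real.norm_of_nonneg (diagMoment_nonneg n)]
  have H := MeasureTheory.hasSum_integral_of_summable_integral_norm
    (μ := MeasureTheory.volume.restrict (Set.Ioc (0 : ℝ) 1)) (F := F) (fun n => by
      have : Continuous (F n) := by fun_prop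
      exact this.integrableOn_Ioc) (by simp only [hnorm]; exact (hsum.mul_left _).norm)
  simp only [hint] at H
  rw [hs3, H.tsum_eq, humpIntegral_eq, intervalIntegral.integral_of_le zero_le_one,
    ← MeasureTheory.integral_const_mul]
  refine MeasureTheory.integral_congr_ae ?_
  rw [Filter.EventuallyEq, MeasureTheory.ae_restrict_iff' measurableSet_Ioc]
  -- On the boundary circle |x(t - t³)| reaches 1 at t = √(1/3); this single point is discarded as a
  -- null set.
  have hne : ∀ᵐ t : ℝ, t ≠ √(1 / 3) :=
    MeasureTheory.compl_mem_ae_iff.2 (MeasureTheory.measure_singleton _)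
  filter_upwards [hne] with t ht ht1
  have ht0 : (t : ℂ) ≠ 0 := by exact_mod_cast ht1.1.ne'
  have hlt : ‖x * hump t‖ < 1 := by
    rw [← sq_lt_one_iff₀ (norm_nonneg _), norm_mul, mul_pow, Complex.norm_real, Real.norm_eq_abs,
      sq_abs]
    have h1 : hump t ^ 2 < 4 / 27 := by
      have h2 : t ^ 2 - 1 / 3 ≠ 0 := by
        intro h
        apply ht
        rw [eq_comm, Real.sqrt_eq_iff_mul_self_eq (by norm_num) ht1.1.le]
        linarith
      have h3 : 0 < (4 / 3 - t ^ 2) * (t ^ 2 - 1 / 3) ^ 2 :=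
        mul_pos (by nlinarith [ht1.1, ht1.2]) (by positivity)
      unfold hump
      linarith [h3, (by ring : (4 / 3 - t ^ 2) * (t ^ 2 - 1 / 3) ^ 2
        = 4 / 27 - (t * (1 - t ^ 2)) ^ 2)]
    nlinarith [sq_nonneg (hump t), sq_nonneg ‖x‖]
  have h := ((hasSum_log_one_add_sub_log_one_sub hlt).div_const (t : ℂ)).mul_left (1 / 2)
  rw [← h.tsum_eq]
  refine tsum_congr fun n => ?_
  simp only [F, hump]
  push_cast
  rw [mul_pow x, mul_pow (t : ℂ)]
  field_simp
  ring

/-! ### The roots of `w³ - w = u³ - u` -/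

theorem sqrtS_sq (u : ℂ) : sqrtS u ^ 2 = 4 - 3 * u ^ 2 :=
  Complex.cpow_nat_inv_pow (4 - 3 * u ^ 2) (n := 2) two_ne_zero

theorem I_mul_sqrtR (u : ℂ) : Complex.I * sqrtR u = -sqrtS u := by
  rw [← neg_I_mul_sqrtR]; ring

theorem sqrtS_re_nonneg (u : ℂ) : 0 ≤ (sqrtS u).re := by
  rcases eq_or_ne (4 - 3 * u ^ 2) 0 with h | h
  · have := sqrtS_sq u
    rw [h, sq_eq_zero_iff] at this
    simp [this]
  · rw [sqrtS, Complex.sqrt, Complex.cpow_def_of_ne_zero h, Complex.exp_re]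
    refine mul_nonneg (Real.exp_pos _).le (Real.cos_nonneg_of_mem_Icc ?_)
    have h1 := Complex.neg_pi_lt_arg (4 - 3 * u ^ 2)
    have h2 := Complex.arg_le_pi (4 - 3 * u ^ 2)
    have e : (Complex.log (4 - 3 * u ^ 2) * (2 : ℂ)⁻¹).im = Complex.arg (4 - 3 * u ^ 2) / 2 := by
      rw [show (2 : ℂ)⁻¹ = ((2⁻¹ : ℝ) : ℂ) by push_cast; rfl, Complex.im_mul_ofReal,
        Complex.log_im]
      ring
    simp only [e]
    constructor <;> linarith

theorem mul_sq_sub_one_ne_zero {v : ℂ} (hv : v.im ≠ 0) : v * (v ^ 2 - 1) ≠ 0 := by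
  rw [show v * (v ^ 2 - 1) = v * ((v - 1) * (v + 1)) by ring]
  refine mul_ne_zero ?_ (mul_ne_zero ?_ ?_)
  · rintro rfl; simp at hv
  · intro h; rw [sub_eq_zero.1 h] at hv; simp at hv
  · intro h; rw [eq_neg_of_add_eq_zero_left h] at hv; simp at hv

theorem isRootTriple_of_sq_eq {v s : ℂ} (hv : v * (v ^ 2 - 1) ≠ 0) (hs : s ^ 2 = 4 - 3 * v ^ 2) :
    IsRootTriple (1 / (v * (v ^ 2 - 1))) v ((-v + s) / 2) ((-v - s) / 2) := by
  refine ⟨by ring, by linear_combination (-1 / 4 : ℂ) * hs, ?_⟩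
  rw [show v * ((-v + s) / 2) * ((-v - s) / 2) = v * (v ^ 2 - 1) by
    linear_combination (-v / 4) * hs]
  exact one_div_mul_cancel hv

/-- For real w the imaginary part of the quadratic is v.im (w + 2 v.re), so w = -2 v.re; its real
part then gives 3 v.re² = 1 + v.im² > 1. -/
theorem im_root_ne_zero_or {v w : ℂ} (hv : v.im ≠ 0) (hw : w ^ 2 + v * w + v ^ 2 - 1 = 0) :
    w.im ≠ 0 ∨ (w.im = 0 ∧ w.re = -2 * v.re ∧ 4 / 3 < w.re ^ 2) := by
  rw [or_iff_not_imp_left, not_not]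
  intro h
  have hre := congrArg Complex.re hw
  have him := congrArg Complex.im hw
  simp [pow_two, h] at hre him
  have h1 : w.re = -2 * v.re := by
    have : v.im * (w.re + 2 * v.re) = 0 := by linear_combination him
    have := (mul_eq_zero.1 this).resolve_left hv
    linarith
  refine ⟨h, h1, ?_⟩
  rw [h1] at hre ⊢
  have : 0 < v.im * v.im := mul_self_pos.2 hv
  nlinarith

/-- If v = a + bi is non-real and v(v² - 1) is real, then 3a² = 1 + b² and v(v² - 1) = -2a(4a² - 1).
With q = 4a² > 4/3, its square minus 4/27 is (q - 4/3)(q - 1/3)² > 0. -/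
theorem one_div_mem_humpDomain {v : ℂ} (hv : v.im ≠ 0) : 1 / (v * (v ^ 2 - 1)) ∈ humpDomain := by
  have h0 := mul_sq_sub_one_ne_zero hv
  have hn : Complex.normSq (v * (v ^ 2 - 1)) ≠ 0 := by simpa using h0
  by_cases h : (v * (v ^ 2 - 1)).im = 0
  · right
    have hre : (v * (v ^ 2 - 1)).re ≠ 0 := fun hr => h0 (Complex.ext hr h)
    rw [one_div, Complex.inv_re, Complex.normSq_apply, h]
    have e : (v * (v ^ 2 - 1)).re / ((v * (v ^ 2 - 1)).re * (v * (v ^ 2 - 1)).re + 0 * 0)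
        = 1 / (v * (v ^ 2 - 1)).re := by field_simp; simp
    rw [e, div_pow, one_pow, div_lt_iff₀ (by positivity)]
    have h1 : 3 * v.re ^ 2 - v.im ^ 2 - 1 = 0 := by
      have : v.im * (3 * v.re ^ 2 - v.im ^ 2 - 1) = 0 := by
        rw [← h]; simp [pow_two]; ring
      exact (mul_eq_zero.1 this).resolve_left hv
    have h2 : (v * (v ^ 2 - 1)).re = -(2 * v.re * (4 * v.re ^ 2 - 1)) := by
      simp [pow_two]
      linear_combination 3 * v.re * h1
    rw [h2]
    have h3 : 1 < 3 * v.re ^ 2 := by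
      have : 0 < v.im ^ 2 := by positivity
      linarith
    have h4 : 0 < (4 * v.re ^ 2 - 4 / 3) * (4 * v.re ^ 2 - 1 / 3) ^ 2 := by
      have : 0 < 4 * v.re ^ 2 - 1 / 3 := by linarith
      exact mul_pos (by linarith) (by positivity)
    nlinarith [h4]
  · left
    rw [one_div, Complex.inv_im]
    exact div_ne_zero (neg_ne_zero.2 h) hn

theorem one_div_im_ne_zero {z : ℂ} (h : z.im ≠ 0) : (1 / z).im ≠ 0 := by
  rw [one_div, Complex.inv_im]
  refine div_ne_zero (neg_ne_zero.2 h) ?_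
  rw [Ne, Complex.normSq_eq_zero]
  rintro rfl
  simp at h

theorem one_div_mem_cutPlane {w : ℂ} (hw : w.im ≠ 0 ∨ w.im = 0 ∧ 1 < w.re ^ 2) :
    1 / w ∈ cutPlane := by
  rcases hw with h | ⟨h, h1⟩
  · exact mem_cutPlane_of_im_ne_zero (one_div_im_ne_zero h)
  · refine mem_cutPlane_of_re_lt_one ?_
    have hw : w = (w.re : ℂ) := by apply Complex.ext <;> simp [h]
    rw [hw, ← Complex.ofReal_one, ← Complex.ofReal_div, Complex.ofReal_re]
    by_contra! hle
    have hpos : 0 < w.re := by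
      by_contra! hn
      have := div_nonpos_of_nonneg_of_nonpos zero_le_one hn
      linarith
    rw [le_div_iff₀ hpos] at hle
    nlinarith

theorem neg_one_div_mem_cutPlane {w : ℂ} (hw : w.im ≠ 0 ∨ w.im = 0 ∧ 1 < w.re ^ 2) :
    -1 / w ∈ cutPlane := by
  have := one_div_mem_cutPlane (w := -w) (by simpa using hw)
  rwa [div_neg, ← neg_div] at this

/-- The six arguments are ±1/w over the three roots. A real root has w² > 4/3, so none of them meets
the cut. -/
theorem termK_eq_humpIntegral {v : ℂ} (hv : v.im ≠ 0) :
    termK v = humpIntegral (1 / (v * (v ^ 2 - 1))) := by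
  have hs := sqrtS_sq v
  have hT := isRootTriple_of_sq_eq (mul_sq_sub_one_ne_zero hv) hs
  have hc : ∀ w : ℂ, w ^ 2 + v * w + v ^ 2 - 1 = 0 → w.im ≠ 0 ∨ w.im = 0 ∧ 1 < w.re ^ 2 := by
    intro w hw
    rcases im_root_ne_zero_or hv hw with h | ⟨h, -, h1⟩
    · exact Or.inl h
    · exact Or.inr ⟨h, by linarith⟩
  have h2 := hc ((-v + sqrtS v) / 2) (by linear_combination (1 / 4 : ℂ) * hs)
  have h3 := hc ((-v - sqrtS v) / 2) (by linear_combination (1 / 4 : ℂ) * hs)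
  have key := sum_Li2_inv_roots hT (one_div_mem_humpDomain hv)
    ⟨one_div_mem_cutPlane (Or.inl hv), neg_one_div_mem_cutPlane (Or.inl hv)⟩
    ⟨one_div_mem_cutPlane h2, neg_one_div_mem_cutPlane h2⟩
    ⟨one_div_mem_cutPlane h3, neg_one_div_mem_cutPlane h3⟩
  rw [termK, show 2 / (-sqrtS v + v) = -1 / ((-v + sqrtS v) / 2) by
      rw [div_div_eq_mul_div, ← neg_div_neg_eq]; ring_nf,
    show 2 / (sqrtS v - v) = 1 / ((-v + sqrtS v) / 2) by
      rw [div_div_eq_mul_div]; ring_nf,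
    show -2 / (sqrtS v + v) = 1 / ((-v - sqrtS v) / 2) by
      rw [div_div_eq_mul_div, ← neg_div_neg_eq]; ring_nf,
    show 2 / (sqrtS v + v) = -1 / ((-v - sqrtS v) / 2) by
      rw [div_div_eq_mul_div, ← neg_div_neg_eq]; ring_nf]
  linear_combination (1 / 2 : ℂ) * key

/-! ### The sum `A + B` -/

/-- With α and β the two values (1 + w)/2 at the roots w = (-v ± √(4 - 3v²))/2, the arguments in A
are the Landen transforms of β and 1 - α. Reflection at α then returns to Li₂(α). -/
theorem termA_add_termB_of_mem {v : ℂ} (hv : v.im ≠ 0) (hα : ((-v + sqrtS v) / 2).im ≠ 0)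
    (hβ : (1 + (-v - sqrtS v) / 2) / 2 ∈ cutPlane) : termA v + termB v = termM v := by
  have hs := sqrtS_sq v
  have h0 := mul_sq_sub_one_ne_zero hv
  have hv0 : v ≠ 0 := by rintro rfl; simp at hv
  have hv1 : v + 1 ≠ 0 := by intro h; rw [eq_neg_of_add_eq_zero_left h] at hv; simp at hv
  have hv2 : v - 1 ≠ 0 := by intro h; rw [sub_eq_zero.1 h] at hv; simp at hv
  set α : ℂ := (sqrtS v - v + 2) / 4 with hαd
  set β : ℂ := (-sqrtS v - v + 2) / 4 with hβd
  have hβm : β ∈ cutPlane := by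
    rw [show β = (1 + (-v - sqrtS v) / 2) / 2 by rw [hβd]; ring]; exact hβ
  have hαim : α.im ≠ 0 := by
    have : α = ((1 / 2 : ℝ) : ℂ) + ((1 / 2 : ℝ) : ℂ) * ((-v + sqrtS v) / 2) := by
      rw [hαd]; push_cast; ring
    rw [this, Complex.add_im, Complex.im_ofReal_mul, Complex.ofReal_im, zero_add]
    exact mul_ne_zero (by norm_num) hα
  have hα1 : (1 - α).im ≠ 0 := by simpa using hαim
  have hα0 : α ≠ 0 := by rintro h; simp [h] at hαim
  have hα10 : 1 - α ≠ 0 := by rintro h; simp [h] at hα1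
  have hβ0 : β - 1 ≠ 0 := by
    rw [← neg_sub]; exact neg_ne_zero.2 (one_sub_ne_zero_of_mem_cutPlane hβm)
  have hsα : sqrtS v = 4 * α + v - 2 := by rw [hαd]; ring
  have hsβ : sqrtS v = -4 * β - v + 2 := by rw [hβd]; ring
  have e1 : (sqrtS v + v ^ 2 - 2) / (v * (v + 1)) = β / (β - 1) := by
    rw [div_eq_div_iff (mul_ne_zero hv0 hv1) hβ0, hβd]
    linear_combination (-1 / 4 : ℂ) * hs
  have e2 : (sqrtS v + v ^ 2 - 2) / ((v - 1) * v) = (1 - α) / ((1 - α) - 1) := by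
    rw [div_eq_div_iff (mul_ne_zero hv2 hv0) (by rw [sub_sub_cancel_left]; exact neg_ne_zero.2 hα0),
      hαd]
    linear_combination (-1 / 4 : ℂ) * hs
  have e3 : (sqrtS v - v ^ 2 + 2) / (v * (v + 1)) = α / (1 - α) := by
    rw [div_eq_div_iff (mul_ne_zero hv0 hv1) hα10, hαd]
    linear_combination (-1 / 4 : ℂ) * hs
  have hL1 := Li2_landen hβm
  have hL2 := Li2_landen (mem_cutPlane_of_im_ne_zero hα1)
  have hR := Li2_reflection (Or.inr hαim) (mem_cutPlane_of_im_ne_zero hαim)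
  have hlog := log_div_one_sub (Or.inr hαim : α ∈ Complex.slitPlane) (Or.inr hα1)
  rw [sub_sub_cancel] at hL2
  rw [termA, termB, termM, neg_I_mul_sqrtR, I_mul_sqrtR, e1, e2, e3,
    show (sqrtS v + v + 2) / 4 = 1 - β by rw [hβd]; ring,
    show (-sqrtS v + v + 2) / 4 = 1 - α by rw [hαd]; ring, hlog]
  linear_combination hL1 - hL2 + hR

theorem termA_add_termB {v : ℂ} (hv : v.im ≠ 0) (hre : 0 ≤ v.re) :
    termA v + termB v = termM v := by
  have hs := sqrtS_sq v
  have hs0 := sqrtS_re_nonneg v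
  have h2 := im_root_ne_zero_or (w := (-v + sqrtS v) / 2) hv
    (by linear_combination (1 / 4 : ℂ) * hs)
  have h3 := im_root_ne_zero_or (w := (-v - sqrtS v) / 2) hv
    (by linear_combination (1 / 4 : ℂ) * hs)
  refine termA_add_termB_of_mem hv ?_ ?_
  -- A real value of this root would give Re √(4 - 3v²) = -3 Re v; both real parts being
  -- non-negative, the root would be 0, against w² > 4/3.
  · rcases h2 with h | ⟨-, h, h'⟩
    · exact h
    · rw [h] at h'
      simp at h
      nlinarith
  · rcases h3 with h | ⟨-, h, -⟩
    · refine mem_cutPlane_of_im_ne_zero ?_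
      simpa using h
    · refine mem_cutPlane_of_re_lt_one ?_
      have : ((1 + (-v - sqrtS v) / 2) / 2).re = (1 + ((-v - sqrtS v) / 2).re) / 2 := by simp
      rw [this, h]
      linarith

/-! ### The sum of all terms -/

/-- The contribution of a root `w` of the cubic to `A + B + J + C + H + D`. -/
noncomputable def rootTerm (w : ℂ) : ℂ :=
  1 / 2 * (Li2 ((1 - w) / 2) - Li2 ((1 + w) / 2))
    + 1 / 4 * (Complex.log (-((1 - w) / 2)) ^ 2 - Complex.log (-((1 + w) / 2)) ^ 2)

theorem rootTerm_eq {w : ℂ} (hw : w.im ≠ 0) :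
    rootTerm w = 1 / 2 * (Li2 (2 / (1 + w)) - Li2 (2 / (1 - w))) := by
  have h1 := Li2_inversion (z := (1 + w) / 2) (by simpa using hw)
  have h2 := Li2_inversion (z := (1 - w) / 2) (by simpa using hw)
  rw [one_div_div] at h1 h2
  rw [rootTerm, h1, h2]
  ring

theorem log_neg_four_div {z : ℂ} (hz : z.im ≠ 0) :
    Complex.log (-4 / z) = -Complex.log (-(z / 4)) := by
  rw [← Complex.log_inv, ← neg_div, inv_div, neg_div, div_neg]
  exact Complex.slitPlane_arg_ne_pi (Or.inr (by simpa using hz))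

theorem im_ne_zero_of_mul_cubic {x w : ℂ} (hx : x.im ≠ 0) (h : x * (w ^ 3 - w) = 1) :
    w.im ≠ 0 := by
  intro hw
  have hw' : w = (w.re : ℂ) := by apply Complex.ext <;> simp [hw]
  rw [hw', ← Complex.ofReal_pow, ← Complex.ofReal_sub] at h
  have him := congrArg Complex.im h
  rw [Complex.im_mul_ofReal, Complex.one_im] at him
  have := (mul_eq_zero.1 him).resolve_left hx
  rw [this] at h
  simp at h

/-- Reflection replaces each Li₂((1 + w)/2) by half of an antisymmetric difference. Its logarithmic
products cancel those in C and H, J and H supply the squared logarithms, and the terms of H + D with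
log((v + 1)/(v - 1)) cancel. -/
theorem sumABJCHD_eq_rootTerm {v : ℂ} (hv : v.im ≠ 0) (hx : (v * (v ^ 2 - 1)).im ≠ 0) :
    ((-v + sqrtS v) / 2).im ≠ 0 ∧ ((-v - sqrtS v) / 2).im ≠ 0 ∧
    sumABJCHD v
      = rootTerm v + rootTerm ((-v + sqrtS v) / 2) + rootTerm ((-v - sqrtS v) / 2) := by
  have hT := isRootTriple_of_sq_eq (mul_sq_sub_one_ne_zero hv) (sqrtS_sq v)
  obtain ⟨-, c2, c3⟩ := hT.mul_cubic
  have hx' := one_div_im_ne_zero hx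
  have h2 := im_ne_zero_of_mul_cubic hx' c2
  have h3 := im_ne_zero_of_mul_cubic hx' c3
  refine ⟨h2, h3, ?_⟩
  have hβ : (1 + (-v - sqrtS v) / 2) / 2 ∈ cutPlane :=
    mem_cutPlane_of_im_ne_zero (by simpa using h3)
  have hAB := termA_add_termB_of_mem hv h2 hβ
  have e2 : (-v + sqrtS v) / 2 = (sqrtS v - v) / 2 := by ring
  have e3 : (-v - sqrtS v) / 2 = (-sqrtS v - v) / 2 := by ring
  rw [e2] at h2 ⊢
  rw [e3] at h3 ⊢
  have i2 : (sqrtS v - v).im ≠ 0 := by simpa using h2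
  have i3 : (-sqrtS v - v).im ≠ 0 := by simpa using h3
  have g2 : (sqrtS v - v + 2).im ≠ 0 := by simpa using i2
  have g3 : (-sqrtS v - v + 2).im ≠ 0 := by simpa using i3
  have g4 : (sqrtS v + v + 2).im ≠ 0 := by
    have : (sqrtS v + v + 2).im = -(-sqrtS v - v).im := by simp; ring
    rw [this]; exact neg_ne_zero.2 i3
  have g5 : (-sqrtS v + v + 2).im ≠ 0 := by
    have : (-sqrtS v + v + 2).im = -(sqrtS v - v).im := by simp; ring
    rw [this]; exact neg_ne_zero.2 i2
  have hJ : termJ v = 1 / 4 * Complex.log (-((1 - (-sqrtS v - v) / 2) / 2)) ^ 2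
      + 1 / 4 * Complex.log (-((1 - (sqrtS v - v) / 2) / 2)) ^ 2
      - 1 / 4 * Complex.log (-((1 + (sqrtS v - v) / 2) / 2)) ^ 2
      - 1 / 4 * Complex.log (-((1 + (-sqrtS v - v) / 2) / 2)) ^ 2 := by
    rw [termJ, neg_I_mul_sqrtR, I_mul_sqrtR, log_neg_four_div g2, log_neg_four_div g3,
      log_neg_four_div g4, log_neg_four_div g5]
    rw [show (sqrtS v + v + 2) / 4 = (1 - (-sqrtS v - v) / 2) / 2 by ring,
      show (-sqrtS v + v + 2) / 4 = (1 - (sqrtS v - v) / 2) / 2 by ring,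
      show (sqrtS v - v + 2) / 4 = (1 + (sqrtS v - v) / 2) / 2 by ring,
      show (-sqrtS v - v + 2) / 4 = (1 + (-sqrtS v - v) / 2) / 2 by ring]
    ring
  have hC : termC v = -(1 / 2) * Complex.log ((1 - (-sqrtS v - v) / 2) / 2)
        * Complex.log ((1 + (-sqrtS v - v) / 2) / 2)
      - 1 / 2 * Complex.log ((1 - (sqrtS v - v) / 2) / 2)
        * Complex.log ((1 + (sqrtS v - v) / 2) / 2) + (Real.pi : ℂ) ^ 2 / 6 := by
    rw [termC, neg_I_mul_sqrtR, I_mul_sqrtR,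
      show (sqrtS v + v + 2) / 4 = (1 - (-sqrtS v - v) / 2) / 2 by ring,
      show (-sqrtS v + v + 2) / 4 = (1 - (sqrtS v - v) / 2) / 2 by ring,
      show (sqrtS v - v + 2) / 4 = (1 + (sqrtS v - v) / 2) / 2 by ring,
      show (-sqrtS v - v + 2) / 4 = (1 + (-sqrtS v - v) / 2) / 2 by ring]
  have hM : termM v = -Li2 ((1 + (sqrtS v - v) / 2) / 2) - Li2 ((1 + (-sqrtS v - v) / 2) / 2) := by
    rw [termM, show (sqrtS v - v + 2) / 4 = (1 + (sqrtS v - v) / 2) / 2 by ring,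
      show (-sqrtS v - v + 2) / 4 = (1 + (-sqrtS v - v) / 2) / 2 by ring]
  have hq : ((v + 1) / (v - 1)).im ≠ 0 := by
    have hv2 : v - 1 ≠ 0 := by intro h; rw [sub_eq_zero.1 h] at hv; simp at hv
    have : (v + 1) / (v - 1) = 1 + ((2 : ℝ) : ℂ) * (1 / (v - 1)) := by push_cast; field_simp; ring
    rw [this, Complex.add_im, Complex.im_ofReal_mul, Complex.one_im, zero_add]
    exact mul_ne_zero two_ne_zero (one_div_im_ne_zero (by simpa using hv))
  have hHD : termH v + termD v = Li2 ((1 - v) / 2)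
      + 1 / 4 * Complex.log (-((1 - v) / 2)) ^ 2 - 1 / 4 * Complex.log (-((1 + v) / 2)) ^ 2
      + 1 / 2 * Complex.log ((1 - v) / 2) * Complex.log ((1 + v) / 2) - (Real.pi : ℂ) ^ 2 / 12 := by
    have l1 : Complex.log ((v - 1) / (v + 1)) = -Complex.log ((v + 1) / (v - 1)) := by
      rw [← Complex.log_inv _ (Complex.slitPlane_arg_ne_pi (Or.inr hq)), inv_div]
    have l2 : Complex.log (2 / (v - 1)) = -Complex.log (-((1 - v) / 2)) := by
      rw [← Complex.log_inv _ (Complex.slitPlane_arg_ne_pi (Or.inr (by simpa using hv))),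
        ← neg_div, inv_div, neg_sub]
    have l3 : Complex.log (-(2 / (v + 1))) = -Complex.log (-((1 + v) / 2)) := by
      rw [← Complex.log_inv _ (Complex.slitPlane_arg_ne_pi (Or.inr (by simpa using hv))),
        inv_neg, inv_div, add_comm]
    rw [termH, termD, l1, l2, l3, show (-v + 1) = 1 - v by ring, add_comm v 1]
    ring
  have refl : ∀ w : ℂ, w.im ≠ 0 → Li2 ((1 + w) / 2) + Li2 ((1 - w) / 2) = (Real.pi : ℂ) ^ 2 / 6
      - Complex.log ((1 + w) / 2) * Complex.log ((1 - w) / 2) := by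
    intro w hw
    have him : ((1 + w) / 2).im ≠ 0 := by simpa using hw
    have := Li2_reflection (Or.inr him) (mem_cutPlane_of_im_ne_zero him)
    rwa [show 1 - (1 + w) / 2 = (1 - w) / 2 by ring] at this
  have r1 := refl v hv
  have r2 := refl _ h2
  have r3 := refl _ h3
  rw [sumABJCHD, hAB, hM, hJ, hC, rootTerm, rootTerm, rootTerm]
  linear_combination hHD + 1 / 2 * r1 - 1 / 2 * r2 - 1 / 2 * r3

theorem sumABJCHD_eq_humpIntegral {v : ℂ} (hv : v.im ≠ 0) (hx : (v * (v ^ 2 - 1)).im ≠ 0) :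
    sumABJCHD v = humpIntegral (1 / (v * (v ^ 2 - 1))) := by
  obtain ⟨h2, h3, h⟩ := sumABJCHD_eq_rootTerm hv hx
  have key := sum_Li2_two_div_roots (isRootTriple_of_sq_eq (mul_sq_sub_one_ne_zero hv)
    (sqrtS_sq v)) (one_div_im_ne_zero hx) hv h2 h3
  rw [h, rootTerm_eq hv, rootTerm_eq h2, rootTerm_eq h3]
  linear_combination (1 / 2 : ℂ) * key

/-! ### Limits -/

theorem continuousAt_humpIntegral_inv {u : ℂ} (h0 : u * (u ^ 2 - 1) ≠ 0)
    (hx : 1 / (u * (u ^ 2 - 1)) ∈ humpDomain) :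
    ContinuousAt (fun v : ℂ => humpIntegral (1 / (v * (v ^ 2 - 1)))) u :=
  ContinuousAt.comp (g := humpIntegral) (f := fun v : ℂ => 1 / (v * (v ^ 2 - 1)))
    (continuousAt_humpIntegral hx) (ContinuousAt.div (by fun_prop) (by fun_prop) h0)

theorem s3Converges_iff_le_norm_sq (u : ℂ) :
    S3Converges u ↔ 4 / 27 ≤ ‖u * (u ^ 2 - 1)‖ ^ 2 := by
  rw [s3Converges_iff]
  constructor
  · rintro ⟨h0, h⟩
    have hpos : 0 < ‖u * (u ^ 2 - 1)‖ ^ 2 := by positivity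
    rw [norm_div, norm_one, div_pow, one_pow, div_le_iff₀ hpos] at h
    linarith
  · intro h
    have h0 : u * (u ^ 2 - 1) ≠ 0 := by
      intro h0; rw [h0] at h; norm_num at h
    have hpos : 0 < ‖u * (u ^ 2 - 1)‖ ^ 2 := by positivity
    refine ⟨h0, ?_⟩
    rw [norm_div, norm_one, div_pow, one_pow, div_le_iff₀ hpos]
    linarith

/-- Covers the non-real points excluded for the long sum: there `humpIntegral` can be replaced by
s₃. -/
theorem s3Converges_of_im_eq_zero {v : ℂ} (hv : v.im ≠ 0) (h : (v * (v ^ 2 - 1)).im = 0) :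
    S3Converges v := by
  rw [s3Converges_iff]
  refine ⟨mul_sq_sub_one_ne_zero hv, ?_⟩
  have hx : (1 / (v * (v ^ 2 - 1))).im = 0 := by rw [one_div, Complex.inv_im, h]; simp
  have hre := (one_div_mem_humpDomain hv).resolve_left (not_not.2 hx)
  rw [Complex.sq_norm, Complex.normSq_apply, hx]
  nlinarith

/-! ### Cancellation of the jumps at a double root -/

theorem log_neg_of_im_neg {z : ℂ} (hz : z.im < 0) :
    Complex.log (-z) = Complex.log z + Real.pi * Complex.I := by
  rw [Complex.log, Complex.log, Complex.arg_neg_eq_arg_add_pi_of_im_neg hz, norm_neg]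
  push_cast
  ring

theorem log_neg_of_im_pos {z : ℂ} (hz : 0 < z.im) :
    Complex.log (-z) = Complex.log z - Real.pi * Complex.I := by
  rw [Complex.log, Complex.log, Complex.arg_neg_eq_arg_sub_pi_of_im_pos hz, norm_neg]
  push_cast
  ring

/-- The part of `rootTerm` that is analytic across the interval `(-1, 1)`. -/
noncomputable def smoothTerm (w : ℂ) : ℂ :=
  1 / 2 * (Li2 ((1 - w) / 2) - Li2 ((1 + w) / 2))
    + 1 / 4 * (Complex.log ((1 - w) / 2) ^ 2 - Complex.log ((1 + w) / 2) ^ 2)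

/-- Half the jump of `rootTerm` across the interval `(-1, 1)`. -/
noncomputable def jumpTerm (w : ℂ) : ℂ :=
  Real.pi * Complex.I / 2 * (Complex.log ((1 - w) / 2) + Complex.log ((1 + w) / 2))

/-- Passing from log(-z) to log z adds πi for (1 - w)/2 and subtracts it for (1 + w)/2, so the π²
terms cancel in the difference of squares. -/
theorem rootTerm_of_im_pos {w : ℂ} (hw : 0 < w.im) : rootTerm w = smoothTerm w + jumpTerm w := by
  rw [rootTerm, smoothTerm, jumpTerm, log_neg_of_im_neg (z := (1 - w) / 2) (by simp; linarith),
    log_neg_of_im_pos (z := (1 + w) / 2) (by simp; linarith)]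
  ring

theorem rootTerm_of_im_neg {w : ℂ} (hw : w.im < 0) : rootTerm w = smoothTerm w - jumpTerm w := by
  rw [rootTerm, smoothTerm, jumpTerm, log_neg_of_im_pos (z := (1 - w) / 2) (by simp; linarith),
    log_neg_of_im_neg (z := (1 + w) / 2) (by simp; linarith)]
  ring

theorem continuousAt_smoothTerm_jumpTerm {c : ℝ} (hc : |c| < 1) :
    ContinuousAt smoothTerm c ∧ ContinuousAt jumpTerm c := by
  obtain ⟨h1, h2⟩ := abs_lt.1 hc
  have hs1 : (1 - (c : ℂ)) / 2 ∈ Complex.slitPlane := Or.inl (by simpa using h2)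
  have hs2 : (1 + (c : ℂ)) / 2 ∈ Complex.slitPlane := Or.inl (by simp; linarith)
  have hc1 : (1 - (c : ℂ)) / 2 ∈ cutPlane := mem_cutPlane_of_re_lt_one (by simp; linarith)
  have hc2 : (1 + (c : ℂ)) / 2 ∈ cutPlane := mem_cutPlane_of_re_lt_one (by simp; linarith)
  have f1 : ContinuousAt (fun w : ℂ => (1 - w) / 2) c := by fun_prop
  have f2 : ContinuousAt (fun w : ℂ => (1 + w) / 2) c := by fun_prop
  have l1 := f1.clog hs1
  have l2 := f2.clog hs2
  have L1 := ContinuousAt.comp (g := Li2) (f := fun w : ℂ => (1 - w) / 2) (continuousAt_Li2 hc1) f1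
  have L2 := ContinuousAt.comp (g := Li2) (f := fun w : ℂ => (1 + w) / 2) (continuousAt_Li2 hc2) f2
  exact ⟨(continuousAt_const.mul (L1.sub L2)).add
    (continuousAt_const.mul ((l1.pow 2).sub (l2.pow 2))), continuousAt_const.mul (l1.add l2)⟩

theorem continuousAt_Li2_two_div {d : ℝ} (hd : 1 < d ^ 2) :
    ContinuousAt (fun w : ℂ => 1 / 2 * (Li2 (2 / (1 + w)) - Li2 (2 / (1 - w)))) d := by
  have key : ∀ e : ℝ, 1 < e ^ 2 → 1 + e ≠ 0 ∧ 2 / (1 + (e : ℂ)) ∈ cutPlane := by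
    intro e he
    have h0 : 1 + e ≠ 0 := by intro h; rw [eq_neg_of_add_eq_zero_right h] at he; norm_num at he
    refine ⟨h0, mem_cutPlane_of_re_lt_one ?_⟩
    have : (2 / (1 + (e : ℂ))) = ((2 / (1 + e) : ℝ) : ℂ) := by push_cast; ring
    rw [this, Complex.ofReal_re]
    rcases lt_or_gt_of_ne h0 with h | h
    · have := div_neg_of_pos_of_neg two_pos h
      linarith
    · rw [div_lt_one h]
      nlinarith
  obtain ⟨a1, m1⟩ := key d hd
  obtain ⟨a2, m2⟩ := key (-d) (by simpa using hd)
  rw [Complex.ofReal_neg, ← sub_eq_add_neg] at m2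
  rw [← sub_eq_add_neg] at a2
  have f1 : ContinuousAt (fun w : ℂ => 2 / (1 + w)) d :=
    ContinuousAt.div (by fun_prop) (by fun_prop) (by exact_mod_cast a1)
  have f2 : ContinuousAt (fun w : ℂ => 2 / (1 - w)) d :=
    ContinuousAt.div (by fun_prop) (by fun_prop) (by exact_mod_cast a2)
  exact continuousAt_const.mul
    ((ContinuousAt.comp (g := Li2) (f := fun w : ℂ => 2 / (1 + w)) (continuousAt_Li2 m1) f1).sub
      (ContinuousAt.comp (g := Li2) (f := fun w : ℂ => 2 / (1 - w)) (continuousAt_Li2 m2) f2))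

/-- The imaginary part of the relation reads p.im (2 p.re + q.re) = -q.im (p.re + 2 q.re), and the
two brackets have the sign of `c`. So roots merging at a non-zero real point come from opposite
half-planes. -/
theorem im_mul_im_neg {p q : ℂ} {c : ℝ} (hp : 0 < p.re * c) (hq : 0 < q.re * c)
    (hq' : q.im ≠ 0) (h : p ^ 2 + p * q + q ^ 2 = 1) : p.im * q.im < 0 := by
  have him := congrArg Complex.im h
  simp [pow_two] at him
  have h1 : p.im * (2 * p.re + q.re) = -(q.im * (p.re + 2 * q.re)) := by linear_combination him
  have hc : c ≠ 0 := by rintro rfl; simp at hp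
  have hB : p.re + 2 * q.re ≠ 0 := by
    intro h0
    have : (p.re + 2 * q.re) * c = 0 := by rw [h0, zero_mul]
    linarith
  have hAB : 0 < (2 * p.re + q.re) * (p.re + 2 * q.re) := by
    have : 0 < ((2 * p.re + q.re) * c) * ((p.re + 2 * q.re) * c) :=
      mul_pos (by linarith) (by linarith)
    rw [show ((2 * p.re + q.re) * c) * ((p.re + 2 * q.re) * c)
      = (2 * p.re + q.re) * (p.re + 2 * q.re) * c ^ 2 by ring] at this
    exact pos_of_mul_pos_left this (sq_nonneg c)
  have h2 : (p.im * q.im) * ((2 * p.re + q.re) * (p.re + 2 * q.re))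
      = -(q.im * (p.re + 2 * q.re)) ^ 2 := by
    linear_combination q.im * (p.re + 2 * q.re) * h1
  have h3 : 0 < (q.im * (p.re + 2 * q.re)) ^ 2 := by positivity
  by_contra! hn
  have := mul_nonneg hn hAB.le
  linarith

/-- At a double root of the cubic, the jumps of the contributions of the two roots cancel. -/
theorem exists_tendsto_rootTerm_sum {l : Filter ℂ} {p q r : ℂ → ℂ} {c : ℝ} (hc : c ^ 2 = 1 / 3)
    (hp : Tendsto p l (𝓝 c)) (hq : Tendsto q l (𝓝 c)) (hr : Tendsto r l (𝓝 ((-2 * c : ℝ) : ℂ)))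
    (him : ∀ᶠ v in l, (p v).im ≠ 0 ∧ (q v).im ≠ 0 ∧ (r v).im ≠ 0)
    (hpq : ∀ v, p v ^ 2 + p v * q v + q v ^ 2 = 1) :
    ∃ L, Tendsto (fun v => rootTerm (p v) + rootTerm (q v) + rootTerm (r v)) l (𝓝 L) := by
  have hc1 : |c| < 1 := by rw [← sq_lt_one_iff_abs_lt_one, hc]; norm_num
  have hcpos : 0 < c * c := by nlinarith
  obtain ⟨hS, hJ⟩ := continuousAt_smoothTerm_jumpTerm hc1
  have hrt := (continuousAt_Li2_two_div (d := -2 * c) (by nlinarith)).tendsto.comp hr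
  have hdiff : Tendsto (fun v => jumpTerm (p v) - jumpTerm (q v)) l (𝓝 0) := by
    have := (hJ.tendsto.comp hp).sub (hJ.tendsto.comp hq)
    rwa [sub_self] at this
  -- `σ` records the half-plane of `p v`, `q v` being in the other one. It may oscillate, but it
  -- multiplies a difference tending to 0.
  let σ : ℂ → ℂ := fun v => if 0 < (p v).im then 1 else -1
  have hσ : Tendsto (fun v => σ v * (jumpTerm (p v) - jumpTerm (q v))) l (𝓝 0) := by
    refine squeeze_zero_norm (fun v => ?_) (tendsto_norm_zero.comp hdiff)
    have : ‖σ v‖ = 1 := by simp only [σ]; split_ifs <;> simp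
    rw [norm_mul, this, one_mul]
    rfl
  refine ⟨_, ((((hS.tendsto.comp hp).add (hS.tendsto.comp hq)).add hσ).add hrt).congr' ?_⟩
  have hre : ∀ {f : ℂ → ℂ}, Tendsto f l (𝓝 c) → ∀ᶠ v in l, 0 < (f v).re * c := by
    intro f hf
    have h1 : Tendsto (fun v => (f v).re * c) l (𝓝 (c * c)) := by
      have := ((Complex.continuous_re.tendsto _).comp hf).mul_const c
      simpa using this
    exact h1.eventually_const_lt hcpos
  filter_upwards [hre hp, hre hq, him] with v h1 h2 ⟨i1, i2, i3⟩
  have hneg := im_mul_im_neg h1 h2 i2 (hpq v)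
  simp only [Function.comp_apply]
  rw [rootTerm_eq i3]
  rcases lt_or_gt_of_ne i1 with h | h
  · have hσv : σ v = -1 := if_neg (not_lt.2 h.le)
    rw [hσv, rootTerm_of_im_neg h, rootTerm_of_im_pos (pos_of_mul_neg_right hneg h.le)]
    ring
  · have hσv : σ v = 1 := if_pos h
    rw [hσv, rootTerm_of_im_pos h, rootTerm_of_im_neg (neg_of_mul_neg_right hneg h.le)]
    ring

/-- At a real point of convergence, either `u² = 1/3` or `u² ≥ 4/3`. -/
theorem sq_of_s3Converges_ofReal {u : ℝ} (h : S3Converges (u : ℂ)) :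
    4 / 27 ≤ (u * (u ^ 2 - 1)) ^ 2 ∧ (u ^ 2 = 1 / 3 ∨ 4 / 3 ≤ u ^ 2) := by
  rw [s3Converges_iff_le_norm_sq] at h
  have e : (u : ℂ) * ((u : ℂ) ^ 2 - 1) = ((u * (u ^ 2 - 1) : ℝ) : ℂ) := by push_cast; ring
  rw [e, Complex.norm_real, Real.norm_eq_abs, sq_abs] at h
  refine ⟨h, ?_⟩
  by_contra! hn
  have h1 : 0 < (u ^ 2 - 1 / 3) ^ 2 := by
    have := sub_ne_zero.2 hn.1
    positivity
  -- Uses (u(u² - 1))² - 4/27 = (u² - 4/3)(u² - 1/3)².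
  nlinarith [mul_pos (sub_pos.2 hn.2) h1]

theorem continuousAt_sqrtS {u : ℝ} (hu : u ^ 2 ≤ 4 / 3) : ContinuousAt sqrtS u := by
  refine ContinuousAt.comp (g := Complex.sqrt) (f := fun v : ℂ => 4 - 3 * v ^ 2)
    (Complex.continuousAt_sqrt (Or.inl ?_)) (by fun_prop)
  rw [show (4 - 3 * (u : ℂ) ^ 2) = ((4 - 3 * u ^ 2 : ℝ) : ℂ) by push_cast; ring,
    Complex.ofReal_re]
  linarith

theorem sqrtS_of_sq_eq_one_third {u : ℝ} (hu : 0 ≤ u) (h : u ^ 2 = 1 / 3) :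
    sqrtS u = 3 * u := by
  have h1 := sqrtS_sq u
  have h2 := sqrtS_re_nonneg u
  have h3 : (u : ℂ) ^ 2 = 1 / 3 := by rw [← Complex.ofReal_pow, h]; norm_num
  have h4 : (sqrtS u) ^ 2 = (3 * u) ^ 2 := by rw [h1, mul_pow, h3]; norm_num
  rcases sq_eq_sq_iff_eq_or_eq_neg.1 h4 with h5 | h5
  · exact h5
  · rw [h5] at h2
    simp at h2
    have : u = 0 := by linarith
    rw [this] at h; norm_num at h

theorem sqrtS_of_sq_eq_four_thirds {u : ℝ} (h : u ^ 2 = 4 / 3) : sqrtS u = 0 := by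
  have h3 : (u : ℂ) ^ 2 = 4 / 3 := by rw [← Complex.ofReal_pow, h]; norm_num
  have h1 := sqrtS_sq u
  rw [h3] at h1
  norm_num at h1
  exact h1

/-- Here x = ±3√3/2 is an endpoint of a removed ray, so continuity of `humpIntegral` is not
available. The roots are u, u, -2u when u² = 1/3, and u, -u/2, -u/2 when u² = 4/3. -/
theorem exists_tendsto_humpIntegral_inv {u : ℝ} (hu : 0 ≤ u)
    (h : u ^ 2 = 1 / 3 ∨ u ^ 2 = 4 / 3) :
    ∃ L, Tendsto (fun v : ℂ => humpIntegral (1 / (v * (v ^ 2 - 1))))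
      (𝓝[{v : ℂ | v.im ≠ 0 ∧ (v * (v ^ 2 - 1)).im ≠ 0}] (u : ℂ)) (𝓝 L) := by
  set l := 𝓝[{v : ℂ | v.im ≠ 0 ∧ (v * (v ^ 2 - 1)).im ≠ 0}] (u : ℂ)
  have hid : Tendsto (fun v : ℂ => v) l (𝓝 u) := tendsto_id.mono_left nhdsWithin_le_nhds
  have hs : Tendsto sqrtS l (𝓝 (sqrtS u)) :=
    (continuousAt_sqrtS (by rcases h with h | h <;> rw [h]; norm_num)).tendsto.mono_left
      nhdsWithin_le_nhds
  have h2 : Tendsto (fun v => (-v + sqrtS v) / 2) l (𝓝 ((-u + sqrtS u) / 2)) :=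
    (hid.neg.add hs).div_const 2
  have h3 : Tendsto (fun v => (-v - sqrtS v) / 2) l (𝓝 ((-u - sqrtS u) / 2)) :=
    (hid.neg.sub hs).div_const 2
  have him : ∀ᶠ v in l, v.im ≠ 0 ∧ (v * (v ^ 2 - 1)).im ≠ 0 := self_mem_nhdsWithin
  rcases h with h | h
  · rw [sqrtS_of_sq_eq_one_third hu h] at h2 h3
    obtain ⟨L, hL⟩ := exists_tendsto_rootTerm_sum (p := fun v => v) h hid
      (h2.trans_eq (by ring_nf)) (h3.trans_eq (by push_cast; ring_nf))
      (by
        filter_upwards [him] with v hv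
        obtain ⟨i2, i3, -⟩ := sumABJCHD_eq_rootTerm hv.1 hv.2
        exact ⟨hv.1, i2, i3⟩)
      (fun v => by linear_combination (1 / 4 : ℂ) * sqrtS_sq v)
    refine ⟨L, hL.congr' ?_⟩
    filter_upwards [him] with v hv
    rw [← sumABJCHD_eq_humpIntegral hv.1 hv.2, (sumABJCHD_eq_rootTerm hv.1 hv.2).2.2]
  · rw [sqrtS_of_sq_eq_four_thirds h] at h2 h3
    obtain ⟨L, hL⟩ := exists_tendsto_rootTerm_sum (r := fun v => v) (c := -u / 2)
      (by rw [div_pow, neg_sq, h]; norm_num)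
      (h2.trans_eq (by push_cast; ring_nf)) (h3.trans_eq (by push_cast; ring_nf))
      (hid.trans_eq (by push_cast; ring_nf))
      (by
        filter_upwards [him] with v hv
        obtain ⟨i2, i3, -⟩ := sumABJCHD_eq_rootTerm hv.1 hv.2
        exact ⟨i2, i3, hv.1⟩)
      (fun v => by linear_combination (1 / 4 : ℂ) * sqrtS_sq v)
    refine ⟨L, hL.congr' ?_⟩
    filter_upwards [him] with v hv
    rw [← sumABJCHD_eq_humpIntegral hv.1 hv.2, (sumABJCHD_eq_rootTerm hv.1 hv.2).2.2]
    ring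

/-- Moving vertically off the real axis does not decrease |v(v² - 1)|, so the points u + ib with
small b > 0 remain in the convergence set. -/
theorem neBot_nhdsWithin_s3Converges {u : ℝ} (hS : S3Converges (u : ℂ))
    (h : u ^ 2 = 1 / 3 ∨ u ^ 2 = 4 / 3) :
    (𝓝[{v : ℂ | (v.im ≠ 0 ∧ (v * (v ^ 2 - 1)).im ≠ 0) ∧ S3Converges v}] (u : ℂ)).NeBot := by
  have ht : Tendsto (fun b : ℝ => (u : ℂ) + b * Complex.I) (𝓝[>] 0)
      (𝓝[{v : ℂ | (v.im ≠ 0 ∧ (v * (v ^ 2 - 1)).im ≠ 0) ∧ S3Converges v}] (u : ℂ)) := by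
    refine tendsto_nhdsWithin_iff.2 ⟨?_, ?_⟩
    · have hc : Continuous fun b : ℝ => (u : ℂ) + b * Complex.I := by fun_prop
      simpa using (hc.tendsto 0).mono_left nhdsWithin_le_nhds
    · filter_upwards [Ioo_mem_nhdsGT (zero_lt_one (α := ℝ))] with b hb
      have hre : ((u : ℂ) + b * Complex.I).re = u := by simp
      have him : ((u : ℂ) + b * Complex.I).im = b := by simp
      set v := (u : ℂ) + b * Complex.I
      have e1 : (v * (v ^ 2 - 1)).re = u * (u ^ 2 - b ^ 2 - 1) - 2 * u * b ^ 2 := by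
        simp [pow_two, hre, him]; ring
      have e2 : (v * (v ^ 2 - 1)).im = b * (3 * u ^ 2 - b ^ 2 - 1) := by
        simp [pow_two, hre, him]; ring
      refine ⟨⟨by rw [him]; exact hb.1.ne', ?_⟩, ?_⟩
      · rw [e2]
        refine mul_ne_zero hb.1.ne' ?_
        rcases h with h | h <;> rw [h] <;> nlinarith [hb.1, hb.2]
      · rw [s3Converges_iff_le_norm_sq, Complex.sq_norm, Complex.normSq_apply, e1, e2]
        refine (sq_of_s3Converges_ofReal hS).1.trans ?_
        have : 0 ≤ u ^ 2 * (2 * u ^ 2 * b ^ 2 + 2 * b ^ 2 + b ^ 4)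
            + b ^ 2 * ((u ^ 2 - b ^ 2 - 1) ^ 2 + 4 * u ^ 2 * b ^ 2) := by positivity
        linarith [this, (by ring : (u * (u ^ 2 - b ^ 2 - 1) - 2 * u * b ^ 2)
            * (u * (u ^ 2 - b ^ 2 - 1) - 2 * u * b ^ 2)
            + b * (3 * u ^ 2 - b ^ 2 - 1) * (b * (3 * u ^ 2 - b ^ 2 - 1))
          = (u * (u ^ 2 - 1)) ^ 2 + (u ^ 2 * (2 * u ^ 2 * b ^ 2 + 2 * b ^ 2 + b ^ 4)
            + b ^ 2 * ((u ^ 2 - b ^ 2 - 1) ^ 2 + 4 * u ^ 2 * b ^ 2)))]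
  exact ht.neBot

theorem tendsto_s3 {u : ℂ} (hS : S3Converges u) :
    Tendsto s3 (𝓝[{v : ℂ | S3Converges v}] u) (𝓝 (s3 u)) :=
  continuousOn_s3 u hS

theorem tendsto_humpIntegral_inv_ofReal {u : ℝ} (hu : 0 ≤ u) (hS : S3Converges (u : ℂ)) :
    Tendsto (fun v : ℂ => humpIntegral (1 / (v * (v ^ 2 - 1))))
      (𝓝[{v : ℂ | v.im ≠ 0}] (u : ℂ)) (𝓝 (s3 u)) := by
  obtain ⟨h1, h2⟩ := sq_of_s3Converges_ofReal hS
  by_cases h : u ^ 2 = 1 / 3 ∨ u ^ 2 = 4 / 3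
  · obtain ⟨L, hL⟩ := exists_tendsto_humpIntegral_inv hu h
    have hs : Tendsto (fun v : ℂ => humpIntegral (1 / (v * (v ^ 2 - 1))))
        (𝓝[{v : ℂ | S3Converges v}] (u : ℂ)) (𝓝 (s3 u)) := by
      refine (tendsto_s3 hS).congr' ?_
      filter_upwards [self_mem_nhdsWithin] with v hv
      exact s3_eq_humpIntegral hv
    have := neBot_nhdsWithin_s3Converges hS h
    have hsub_im : {v : ℂ | (v.im ≠ 0 ∧ (v * (v ^ 2 - 1)).im ≠ 0) ∧ S3Converges v}
        ⊆ {v : ℂ | v.im ≠ 0 ∧ (v * (v ^ 2 - 1)).im ≠ 0} := fun v hv => hv.1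
    have hsub_conv : {v : ℂ | (v.im ≠ 0 ∧ (v * (v ^ 2 - 1)).im ≠ 0) ∧ S3Converges v}
        ⊆ {v : ℂ | S3Converges v} := fun v hv => hv.2
    have hLs : L = s3 u := tendsto_nhds_unique
      (hL.mono_left (nhdsWithin_mono _ hsub_im))
      (hs.mono_left (nhdsWithin_mono _ hsub_conv))
    rw [hLs] at hL
    -- Near `u` every non-real `v` has v(v² - 1) non-real, where the first limit applies, or real,
    -- where the series converges and the second does.
    have hun := hL.sup hs
    rw [← nhdsWithin_union] at hun
    refine hun.mono_left (nhdsWithin_mono _ fun v hv => ?_)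
    by_cases hx : (v * (v ^ 2 - 1)).im = 0
    · exact Or.inr (s3Converges_of_im_eq_zero hv hx)
    · exact Or.inl ⟨hv, hx⟩
  · push Not at h
    have hgt : 4 / 3 < u ^ 2 := lt_of_le_of_ne (h2.resolve_left h.1) (Ne.symm h.2)
    have hx : 1 / ((u : ℂ) * ((u : ℂ) ^ 2 - 1)) ∈ humpDomain := by
      right
      rw [show 1 / ((u : ℂ) * ((u : ℂ) ^ 2 - 1)) = ((1 / (u * (u ^ 2 - 1)) : ℝ) : ℂ) by
        push_cast; ring, Complex.ofReal_re, div_pow, one_pow]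
      have h3 : 0 < (u ^ 2 - 4 / 3) * (u ^ 2 - 1 / 3) ^ 2 := by
        have : 0 < u ^ 2 - 1 / 3 := by linarith
        exact mul_pos (by linarith) (by positivity)
      have h4 : 4 / 27 < (u * (u ^ 2 - 1)) ^ 2 := by
        linarith [h3, (by ring : (u ^ 2 - 4 / 3) * (u ^ 2 - 1 / 3) ^ 2
          = (u * (u ^ 2 - 1)) ^ 2 - 4 / 27)]
      rw [div_lt_iff₀ (by linarith)]
      linarith
    rw [s3_eq_humpIntegral hS]
    exact (continuousAt_humpIntegral_inv hS.1 hx).tendsto.mono_left nhdsWithin_le_nhds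

/-! ### Continuity of `termM` at real points, and the conclusion -/

theorem continuousAt_termM {u : ℂ} (h1 : (sqrtS u - u + 2) / 4 ∈ cutPlane)
    (h2 : (-sqrtS u - u + 2) / 4 ∈ cutPlane) : ContinuousAt termM u := by
  -- The principal root may jump at `u`, but M is symmetric in the two roots. The root nearer to
  -- `sqrtS u` is continuous there, since |σ - s|² ≤ |σ - s||σ + s| = |σ² - s²| with s = `sqrtS u`.
  let σ : ℂ → ℂ := fun v =>
    if ‖sqrtS v - sqrtS u‖ ≤ ‖sqrtS v + sqrtS u‖ then sqrtS v else -sqrtS v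
  have hσ : Tendsto σ (𝓝 u) (𝓝 (sqrtS u)) := by
    rw [tendsto_iff_norm_sub_tendsto_zero]
    have hb : ∀ v, ‖σ v - sqrtS u‖ ≤ √‖(4 - 3 * v ^ 2) - (4 - 3 * u ^ 2)‖ := by
      intro v
      refine Real.le_sqrt_of_sq_le ?_
      rw [← sqrtS_sq, ← sqrtS_sq, sq_sub_sq, norm_mul, pow_two]
      simp only [σ]
      split_ifs with h
      · exact mul_le_mul_of_nonneg_right h (norm_nonneg _)
      · rw [← neg_add', norm_neg]
        exact mul_le_mul_of_nonneg_left (not_le.1 h).le (norm_nonneg _)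
    refine squeeze_zero (fun v => norm_nonneg _) hb ?_
    have hc : Continuous fun v : ℂ => √‖(4 - 3 * v ^ 2) - (4 - 3 * u ^ 2)‖ := by fun_prop
    simpa using hc.tendsto u
  have hid : Tendsto (fun v : ℂ => v) (𝓝 u) (𝓝 u) := tendsto_id
  have t1 : Tendsto (fun v => (σ v - v + 2) / 4) (𝓝 u) (𝓝 ((sqrtS u - u + 2) / 4)) :=
    ((hσ.sub hid).add_const 2).div_const 4
  have t2 : Tendsto (fun v => (-σ v - v + 2) / 4) (𝓝 u) (𝓝 ((-sqrtS u - u + 2) / 4)) :=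
    ((hσ.neg.sub hid).add_const 2).div_const 4
  refine ((((continuousAt_Li2 h1).tendsto.comp t1).neg).sub
    ((continuousAt_Li2 h2).tendsto.comp t2)).congr fun v => ?_
  simp only [Function.comp_apply, σ, termM]
  split_ifs
  · rfl
  · rw [neg_neg]; ring

theorem continuousAt_termM_ofReal {u : ℝ} (hu : 0 ≤ u) (h : u ^ 2 = 1 / 3 ∨ 4 / 3 ≤ u ^ 2) :
    ContinuousAt termM u := by
  rcases h with h | h
  · have hs := sqrtS_of_sq_eq_one_third hu h
    have e : (3 * (u : ℂ)).re = 3 * u := by simp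
    refine continuousAt_termM (mem_cutPlane_of_re_lt_one ?_) (mem_cutPlane_of_re_lt_one ?_)
    · rw [hs]; simp; nlinarith
    · rw [hs]; simp; nlinarith
  · have hre : (sqrtS u).re = 0 := by
      have h1 := sqrtS_sq u
      rw [show (4 - 3 * (u : ℂ) ^ 2) = ((4 - 3 * u ^ 2 : ℝ) : ℂ) by push_cast; ring] at h1
      have a := congrArg Complex.re h1
      have b := congrArg Complex.im h1
      rw [Complex.ofReal_re] at a
      rw [Complex.ofReal_im] at b
      simp [pow_two] at a b
      have b' : (sqrtS u).re * (sqrtS u).im = 0 := by linarith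
      rcases mul_eq_zero.1 b' with h0 | h0
      · exact h0
      · rw [h0] at a
        nlinarith
    refine continuousAt_termM (mem_cutPlane_of_re_lt_one ?_) (mem_cutPlane_of_re_lt_one ?_)
    · simp [hre]; linarith
    · simp [hre]; linarith

theorem theorem1 :
    -- non-real arguments
    (∀ u : ℂ, u.im ≠ 0 → 0 ≤ u.re → S3Converges u →
      -- off the curve on which a logarithm in `J` and one in `C` meet their branch cut
      (((u * (u ^ 2 - 1)).im ≠ 0 → sumABJCHD u = s3 u) ∧
        -- at every point, in particular on that curve, as a limit
        Tendsto sumABJCHD (𝓝[{v : ℂ | v.im ≠ 0 ∧ (v * (v ^ 2 - 1)).im ≠ 0}] u) (𝓝 (s3 u)) ∧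
        s3 u = termK u ∧
        termA u + termB u = termM u)) ∧
    -- real arguments, by limits from non-real ones
    (∀ u : ℝ, 0 ≤ u → S3Converges (u : ℂ) →
      Tendsto sumABJCHD (𝓝[{v : ℂ | v.im ≠ 0 ∧ (v * (v ^ 2 - 1)).im ≠ 0}] (u : ℂ))
          (𝓝 (s3 u)) ∧
        Tendsto s3 (𝓝[{v : ℂ | v.im ≠ 0 ∧ S3Converges v}] (u : ℂ)) (𝓝 (s3 u)) ∧
        Tendsto termK (𝓝[{v : ℂ | v.im ≠ 0}] (u : ℂ)) (𝓝 (s3 u)) ∧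
        Tendsto (fun v => termA v + termB v) (𝓝[{v : ℂ | v.im ≠ 0}] (u : ℂ))
          (𝓝 (termM u)) ∧
        Tendsto termM (𝓝[{v : ℂ | v.im ≠ 0}] (u : ℂ)) (𝓝 (termM u))) := by
  refine ⟨fun u hu hre hS => ⟨fun hx => ?_, ?_, ?_, termA_add_termB hu hre⟩,
    fun u hu hS => ⟨?_, ?_, ?_, ?_, ?_⟩⟩
  · rw [sumABJCHD_eq_humpIntegral hu hx, s3_eq_humpIntegral hS]
  · rw [s3_eq_humpIntegral hS]
    refine ((continuousAt_humpIntegral_inv hS.1 (one_div_mem_humpDomain hu)).tendsto.mono_left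
      nhdsWithin_le_nhds).congr' ?_
    filter_upwards [self_mem_nhdsWithin] with v hv
    exact (sumABJCHD_eq_humpIntegral hv.1 hv.2).symm
  · rw [s3_eq_humpIntegral hS, termK_eq_humpIntegral hu]
  · refine ((tendsto_humpIntegral_inv_ofReal hu hS).mono_left
      (nhdsWithin_mono _ fun v hv => hv.1)).congr' ?_
    filter_upwards [self_mem_nhdsWithin] with v hv
    exact (sumABJCHD_eq_humpIntegral hv.1 hv.2).symm
  · exact (tendsto_s3 hS).mono_left (nhdsWithin_mono _ fun v hv => hv.2)
  · refine (tendsto_humpIntegral_inv_ofReal hu hS).congr' ?_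
    filter_upwards [self_mem_nhdsWithin] with v hv
    exact (termK_eq_humpIntegral hv).symm
  · have h := (sq_of_s3Converges_ofReal hS).2
    -- Strict positivity makes the nearby non-real `v` have positive real part, where A + B = M
    -- holds exactly.
    have hpos : 0 < u := lt_of_le_of_ne hu fun h0 => by
      rw [← h0] at h; norm_num at h
    have hre : ∀ᶠ v : ℂ in 𝓝 (u : ℂ), 0 < v.re :=
      (Complex.continuous_re.tendsto (u : ℂ)).eventually_const_lt (by simpa using hpos)
    refine ((continuousAt_termM_ofReal hu h).tendsto.mono_left nhdsWithin_le_nhds).congr' ?_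
    filter_upwards [self_mem_nhdsWithin, nhdsWithin_le_nhds hre] with v hv hv'
    exact (termA_add_termB hv hv'.le).symm
  · exact (continuousAt_termM_ofReal hu (sq_of_s3Converges_ofReal hS).2).tendsto.mono_left
      nhdsWithin_le_nhds
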